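/- **Problem.** Let $n,m,d\ge 1$, $\mu,\tilde L,\lambda>0$, and let $\tilde f_{i,j}:\mathbb R^d\to\mathbb R$ ($1\le i\le n$, $1\le j\le m$) be differentiable, $\tilde L$-smooth (the gradient is $\tilde L$-Lipschitz) and $\mu$-strongly convex ($\tilde f_{i,j}(v)\ge \tilde f_{i,j}(u)+\langle\nabla \tilde f_{i,j}(u),v-u\rangle+\frac\mu2\|v-u\|^2$). Put $f_i=\frac1m\sum_j\tilde f_{i,j}$ and, for $x=[x_1,\dots,x_n]\in\mathbb R^{nd}$ with mean $\bar x=\frac1n\sum_i x_i$, $$F(x)=\frac1n\sum_{i=1}^n f_i(x_i)+\frac{\lambda}{2n}\sum_{i=1}^n\|x_i-\bar x\|^2 .$$ Let $x^\star$ be the minimizer of $F$. **Algorithm AL2SGD+** (parameters $p,\rho,\eta,\theta_1,\theta_2,\gamma,\beta$). Start from $y^0=z^0=w^0=x^0$. In iteration $k=0,1,2,\dots$: - $x^k=\theta_1z^k+\theta_2w^k+(1-\theta_1-\theta_2)y^k$. - Draw $\xi_k\in\{0,1\}$ with $\Pr(\xi_k=1)=p$, and indices $j_i^k$, each uniform on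 $\{1,\dots,m\}$. If $\xi_k=0$, set $$g_i^k=\tfrac{1}{n(1-p)}\big(\nabla\tilde f_{i,j_i^k}(x_i^k)-\nabla\tilde f_{i,j_i^k}(w_i^k)\big)+\tfrac1n\nabla f_i(w_i^k)+\tfrac\lambda n(w_i^k-\bar w^k);$$ if $\xi_k=1$, set $$g_i^k=\tfrac{\lambda}{np}(x_i^k-\bar x^k)-\tfrac{(p^{-1}-1)\lambda}{n}(w_i^k-\bar w^k)+\tfrac1n\nabla f_i(w_i^k).$$ - $y^{k+1}=x^k-\eta g^k$ and $z^{k+1}=\beta z^k+(1-\beta)x^k+\frac\gamma\eta(y^{k+1}-x^k)$. - Draw $\xi'_k\in\{0,1\}$ with $\Pr(\xi'_k=1)=\rho$; set $w^{k+1}=y^{k+1}$ if $\xi'_k=1$ and $w^{k+1}=w^k$ otherwise. The draws $\xi_k$, $\xi'_k$, $(j^k_i)_i$ are independent of each other and across iterations (the joint law of $(j_i^k)_i$ over the clients $i$ is arbitrary). **Parameters.** $\mathcal L=\max\{\frac{\tilde L}{n(1-p)},\frac{\lambda}{np}\}$, $L_F=\frac1n(\lambda+\tilde L)$, $\eta=\frac14\max\{L_F,\mathcal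 L\}^{-1}$, $\theta_2=\frac{\mathcal L}{2\max\{L_F,\mathcal L\}}$, $\theta_1=\min\{\frac12,\sqrt{\frac{\eta\mu}{n}\max\{\frac12,\frac{\theta_2}{\rho}\}}\}$, $\gamma=\max\{\frac{2\mu}n,\frac{4\theta_1}{\eta}\}^{-1}$, $\beta=1-\frac{\gamma\mu}n$. Accuracy is measured by $$\Psi^k=\|z^k-x^\star\|^2+\frac{2\gamma\beta}{\theta_1}[F(y^k)-F(x^\star)]+\frac{(2\theta_2+\theta_1)\gamma\beta}{\theta_1\rho}[F(w^k)-F(x^\star)].$$ **Costs.** The number of communication rounds in the first $K$ iterations is $1$ (set-up) plus the number of $k<K$ with $\xi'_k=1$ plus the number of $1\le k<K$ with $\xi_k\ne\xi_{k-1}$. The number of local summand gradients (per client) in the first $K$ iterations is $m$ (set-up) plus $m$ for each $k<K$ with $\xi'_k=1$ plus $2$ for each $k<K$ with $\xi_k=0$. **Theorem.** There is a universal constant $C>0$ such that for all $n,m,d,\mu,\tilde L,\lambda$ as above and all $0<\varepsilon\le\frac12$, with $p=\frac{\lambda}{\lambda+\tilde L}$, the following holds. 1. If $\rho=p(1-p)$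 and $\lambda\ge\mu$, there is an iteration number $K$, depending only on $n,m,d,\mu,\tilde L,\lambda,\varepsilon$, such that for all such $\tilde f_{i,j}$ and all starting points $x^0$, $\mathbb E\Psi^k\le\varepsilon\Psi^0$ for all $k\ge K$, and the expected number of communication rounds in the first $K$ iterations is at most $C\sqrt{\frac{\min\{\tilde L,\lambda\}}{\mu}}\log\frac1\varepsilon$. 2. If $\rho=\frac1m$, there is an iteration number $K$, depending only on $n,m,d,\mu,\tilde L,\lambda,\varepsilon$, such that for all such $\tilde f_{i,j}$ and all starting points $x^0$, $\mathbb E\Psi^k\le\varepsilon\Psi^0$ for all $k\ge K$, and the expected number of local summand gradients in the first $K$ iterations is at most $C\Big(m+\sqrt{\frac{m(\tilde L+\lambda)}{\mu}}\Big)\log\frac1\varepsilon$. -/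

import Mathlib

noncomputable section

namespace AL2SGD

/-- The space of one client's model. -/
abbrev Model (d : ℕ) : Type := EuclideanSpace ℝ (Fin d)

/-- The space of joint vectors `x = [x_1, …, x_n]`, with the Euclidean norm. -/
abbrev Joint (n d : ℕ) : Type := PiLp 2 (fun _ : Fin n => Model d)

/-- `L`-smoothness: differentiable with an `L`-Lipschitz gradient. -/
def Smooth {d : ℕ} (L : ℝ) (h : Model d → ℝ) : Prop :=
  Differentiable ℝ h ∧ ∀ u v : Model d, ‖gradient h u - gradient h v‖ ≤ L * ‖u - v‖

/-- `μ`-strong convexity of a differentiable function. -/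
def StronglyConvex {d : ℕ} (μ : ℝ) (h : Model d → ℝ) : Prop :=
  Differentiable ℝ h ∧
    ∀ u v : Model d, h u + inner ℝ (gradient h u) (v - u) + μ / 2 * ‖v - u‖ ^ 2 ≤ h v

/-- The local loss `f_i`, the average of the `m` summands of client `i`. -/
def localLoss {n m d : ℕ} (ft : Fin n → Fin m → Model d → ℝ) (i : Fin n) (u : Model d) : ℝ :=
  (1 / (m : ℝ)) * ∑ j : Fin m, ft i j u

/-- The average of the `n` local models. -/
def mean {n d : ℕ} (x : Joint n d) : Model d :=
  (1 / (n : ℝ)) • ∑ i : Fin n, x i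

/-- The dissimilarity penalty `ψ`. -/
def penalty {n d : ℕ} (x : Joint n d) : ℝ :=
  (1 / (2 * (n : ℝ))) * ∑ i : Fin n, ‖x i - mean x‖ ^ 2

/-- The objective `F = f + lam * ψ`. -/
def objective {n m d : ℕ} (ft : Fin n → Fin m → Model d → ℝ) (lam : ℝ) (x : Joint n d) : ℝ :=
  (1 / (n : ℝ)) * ∑ i : Fin n, localLoss ft i (x i) + lam * penalty x

/-- The scalar parameters of the algorithm; `p` is the probability of an aggregation step and
`ρ` the probability of a refresh of the reference point `w`. -/
structure Params where
  p : ℝ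
  ρ : ℝ
  η : ℝ
  θ₁ : ℝ
  θ₂ : ℝ
  γ : ℝ
  β : ℝ

/-- The expected smoothness constant of the gradient estimator. -/
def expSmooth (n : ℕ) (L lam p : ℝ) : ℝ :=
  max (L / ((n : ℝ) * (1 - p))) (lam / ((n : ℝ) * p))

/-- The smoothness constant of the objective. -/
def objSmooth (n : ℕ) (L lam : ℝ) : ℝ := (1 / (n : ℝ)) * (lam + L)

def etaOf (n : ℕ) (L lam p : ℝ) : ℝ :=
  (1 / 4) * (max (objSmooth n L lam) (expSmooth n L lam p))⁻¹

def thetaTwoOf (n : ℕ) (L lam p : ℝ) : ℝ :=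
  expSmooth n L lam p / (2 * max (objSmooth n L lam) (expSmooth n L lam p))

def thetaOneOf (n : ℕ) (μ L lam p ρ : ℝ) : ℝ :=
  min (1 / 2)
    (Real.sqrt (etaOf n L lam p * μ / (n : ℝ) * max (1 / 2) (thetaTwoOf n L lam p / ρ)))

def gammaOf (n : ℕ) (μ L lam p ρ : ℝ) : ℝ :=
  1 / max (2 * μ / (n : ℝ)) (4 * thetaOneOf n μ L lam p ρ / etaOf n L lam p)

/-- The parameter choice, for given probabilities `p` and `ρ`. -/
def params (n : ℕ) (μ L lam p ρ : ℝ) : Params where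
  p := p
  ρ := ρ
  η := etaOf n L lam p
  θ₁ := thetaOneOf n μ L lam p ρ
  θ₂ := thetaTwoOf n L lam p
  γ := gammaOf n μ L lam p ρ
  β := 1 - gammaOf n μ L lam p ρ * μ / (n : ℝ)

/-- The state `(y^k, z^k, w^k)` carried from one iteration to the next. -/
structure State (n d : ℕ) where
  y : Joint n d
  z : Joint n d
  w : Joint n d

/-- The point `x^k` computed at the beginning of iteration `k`. -/
def State.x {n d : ℕ} (a : Params) (s : State n d) : Joint n d :=
  a.θ₁ • s.z + a.θ₂ • s.w + (1 - a.θ₁ - a.θ₂) • s.y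

/-- The variance reduced estimator `g^k` of the gradient of the objective, for the coin `agg`
(`true` for an aggregation step, `false` for a local step) and the indices `idx i` of the summands
sampled by the clients. -/
def gradEst {n m d : ℕ} (ft : Fin n → Fin m → Model d → ℝ) (lam p : ℝ) (agg : Bool)
    (idx : Fin n → Fin m) (x w : Joint n d) : Joint n d :=
  WithLp.toLp 2 fun i : Fin n =>
    if agg then
      (lam / ((n : ℝ) * p)) • (x i - mean x)
        - ((p⁻¹ - 1) * lam / (n : ℝ)) • (w i - mean w)
        + (1 / (n : ℝ)) • gradient (localLoss ft i) (w i)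
    else
      (1 / ((n : ℝ) * (1 - p))) •
          (gradient (ft i (idx i)) (x i) - gradient (ft i (idx i)) (w i))
        + (1 / (n : ℝ)) • gradient (localLoss ft i) (w i)
        + (lam / (n : ℝ)) • (w i - mean w)

/-- The updated `y^{k+1}`. -/
def nextY {n m d : ℕ} (ft : Fin n → Fin m → Model d → ℝ) (lam : ℝ) (a : Params) (agg : Bool)
    (idx : Fin n → Fin m) (s : State n d) : Joint n d :=
  s.x a - a.η • gradEst ft lam a.p agg idx (s.x a) s.w

/-- One iteration of AL2SGD+; `refresh` is the second coin of the iteration. -/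
def step {n m d : ℕ} (ft : Fin n → Fin m → Model d → ℝ) (lam : ℝ) (a : Params)
    (agg refresh : Bool) (idx : Fin n → Fin m) (s : State n d) : State n d where
  y := nextY ft lam a agg idx s
  z := a.β • s.z + (1 - a.β) • s.x a + (a.γ / a.η) • (nextY ft lam a agg idx s - s.x a)
  w := if refresh then nextY ft lam a agg idx s else s.w

/-- The iterates of AL2SGD+ started at `x0`, along given sequences of coins and indices. -/
def iter {n m d : ℕ} (ft : Fin n → Fin m → Model d → ℝ) (lam : ℝ) (a : Params) (x0 : Joint n d)
    (agg refresh : ℕ → Bool) (idx : ℕ → Fin n → Fin m) : ℕ → State n d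
  | 0 => ⟨x0, x0, x0⟩
  | k + 1 => step ft lam a (agg k) (refresh k) (idx k) (iter ft lam a x0 agg refresh idx k)

/-- The Lyapunov function of AL2SGD+, relative to a minimizer `xs`. -/
def lyapunov {n m d : ℕ} (ft : Fin n → Fin m → Model d → ℝ) (lam : ℝ) (a : Params)
    (xs : Joint n d) (s : State n d) : ℝ :=
  ‖s.z - xs‖ ^ 2
    + 2 * a.γ * a.β / a.θ₁ * (objective ft lam s.y - objective ft lam xs)
    + (2 * a.θ₂ + a.θ₁) * a.γ * a.β / (a.θ₁ * a.ρ) * (objective ft lam s.w - objective ft lam xs)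

/-- The number of communication rounds in the first `K` iterations: one for the set-up (the
averages at the common starting point), one for every refresh of the reference point, and one
whenever two consecutive aggregation coins differ. No communication is needed between consecutive
equal coins: a local step uses only averages at `w`, and the average of `g^k` in an aggregation
step is `1 / n` times the average of the gradients `∇ f_i (w_i^k)`, so that averages of the
iterates that are known before an aggregation step are known after it. -/
def commRounds (agg refresh : ℕ → Bool) (K : ℕ) : ℕ :=
  1 + ∑ k ∈ Finset.range K, (if refresh k then 1 else 0)
    + ∑ k ∈ Finset.range (K - 1), (if agg (k + 1) ≠ agg k then 1 else 0)

/-- The number of summand gradients that each client evaluates in the first `K` iterations: `m` at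
the set-up and at every refresh of the reference point (a full local gradient), and two in every
local step (the same summand at `x` and at `w`). -/
def summandGrads (m : ℕ) (agg refresh : ℕ → Bool) (K : ℕ) : ℕ :=
  m + ∑ k ∈ Finset.range K, ((if agg k then 0 else 2) + (if refresh k then m else 0))

/-- The randomness of AL2SGD+: in every iteration the aggregation coin is `true` with probability
`p`, the refresh coin is `true` with probability `ρ`, and the index of every client is uniform on
its `m` summands. The two coins and the tuple of indices are independent of each other and of all
other iterations; the joint law of the indices of different clients within one iteration is
arbitrary (independent indices and one shared index are both allowed). -/
structure IsSampling {Ω : Type*} [MeasurableSpace Ω] (P : MeasureTheory.Measure Ω) {n m : ℕ}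
    (p ρ : ℝ) (agg refresh : ℕ → Ω → Bool) (idx : ℕ → Ω → Fin n → Fin m) : Prop where
  measurable_agg : ∀ k, Measurable (agg k)
  measurable_refresh : ∀ k, Measurable (refresh k)
  measurable_idx : ∀ k, Measurable (idx k)
  prob_agg : ∀ k, P.real {ω | agg k ω = true} = p
  prob_refresh : ∀ k, P.real {ω | refresh k ω = true} = ρ
  prob_idx : ∀ k i j, P.real {ω | idx k ω i = j} = 1 / (m : ℝ)
  indep_iterations :
    ProbabilityTheory.iIndepFun (fun (k : ℕ) (ω : Ω) => (agg k ω, refresh k ω, idx k ω)) P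
  indep_agg : ∀ k, ProbabilityTheory.IndepFun (agg k) (fun ω => (refresh k ω, idx k ω)) P
  indep_refresh : ∀ k, ProbabilityTheory.IndepFun (refresh k) (idx k) P

/-- The value of the Lyapunov function after `k` iterations, as a random variable. -/
def lyapunovAt {Ω : Type*} {n m d : ℕ} (ft : Fin n → Fin m → Model d → ℝ) (lam : ℝ) (a : Params)
    (x0 xs : Joint n d) (agg refresh : ℕ → Ω → Bool) (idx : ℕ → Ω → Fin n → Fin m)
    (k : ℕ) (ω : Ω) : ℝ :=
  lyapunov ft lam a xs
    (iter ft lam a x0 (fun t => agg t ω) (fun t => refresh t ω) (fun t => idx t ω) k)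

end AL2SGD

end

noncomputable section

namespace AL2SGD

open MeasureTheory ProbabilityTheory

/-! ### Smooth and strongly convex functions -/

/-! With `p = lam / (lam + L)` both branches of the estimator have the same constant `L / (n (1 -
p)) = lam / (n p) = (lam + L) / n =: M`, which is also the smoothness constant of the objective `F`.
Hence `η = 1 / (4 M)` and `θ₂ = 1 / 2`, and the method is an accelerated loopless variance-reduced
scheme for `F`, which is strongly convex with constant `σ = μ / n`.

The estimator is unbiased with second moment at most `‖∇F(x)‖² + 2 M D`, where `D = F(w) - F(x) -
⟨∇F(x), w - x⟩` (`expect_sq_norm_gradEst_le`). Add `t = 2 γ β / θ₁` times the descent inequality for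
the new `y` to the squared distance of the new `z`. The coupling that defines `x` rewrites `θ₁
⟨∇F(x), z - x⟩` through `w - x` and `y - x`. The variance contributes at most `t η · 2 M D = (t / 2)
D`, whose inner product cancels the one with `w - x` exactly because `θ₂ = 1 / 2`; convexity handles
the rest (`drift_estimate`). Averaging over the coins gives a contraction of `potential` by `1 - ρ
θ₁ / 2` (`expect_step_potential_le`), and `lyapunov` is within a factor `4` of `potential`.

So `K ≈ 2 log (4 / ε) / (ρ θ₁)` iterations suffice, that is, `ρ K = O((1 + √(ρ (lam + L) / μ)) log
(1 / ε))`. For `ρ = p (1 - p)` an iteration costs about `ρ + 2 p (1 - p) = 3 ρ` expected rounds, and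
`ρ (lam + L) = lam L / (lam + L) ≤ min L lam`. For `ρ = 1 / m` an iteration costs at most `3`
expected gradients, and `K = m (ρ K)`. -/

theorem Smooth.le_quadratic {d : ℕ} {L : ℝ} {h : Model d → ℝ} (hs : Smooth L h) (u v : Model d) :
    h v ≤ h u + inner ℝ (gradient h u) (v - u) + L / 2 * ‖v - u‖ ^ 2 := by
  have hline : ∀ t : ℝ, HasDerivAt (fun t : ℝ => u + t • (v - u)) (v - u) t := fun t => by
    simpa using ((hasDerivAt_id t).smul_const (v - u)).const_add u
  have hd : ∀ t : ℝ, HasDerivAt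
      (fun t : ℝ => h (u + t • (v - u)) - t * inner ℝ (gradient h u) (v - u)
        - L / 2 * ‖v - u‖ ^ 2 * t ^ 2)
      (inner ℝ (gradient h (u + t • (v - u))) (v - u) - inner ℝ (gradient h u) (v - u)
        - L * ‖v - u‖ ^ 2 * t) t := fun t => by
    have h1 : HasDerivAt (fun t : ℝ => h (u + t • (v - u)))
        (inner ℝ (gradient h (u + t • (v - u))) (v - u)) t := by
      rw [inner_gradient_left]
      exact (hs.1 (u + t • (v - u))).hasFDerivAt.comp_hasDerivAt t (hline t)
    refine ((h1.sub ((hasDerivAt_id t).mul_const (inner ℝ (gradient h u) (v - u)))).sub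
      ((hasDerivAt_pow 2 t).const_mul (L / 2 * ‖v - u‖ ^ 2))).congr_deriv ?_
    push_cast
    ring
  -- On `[0, 1]` the gap to the quadratic model has derivative at most `0`, by Cauchy–Schwarz and
  -- the Lipschitz bound; compare the endpoints.
  have hanti : AntitoneOn (fun t : ℝ => h (u + t • (v - u)) - t * inner ℝ (gradient h u) (v - u)
        - L / 2 * ‖v - u‖ ^ 2 * t ^ 2) (Set.Icc 0 1) := by
    refine antitoneOn_of_deriv_nonpos (convex_Icc 0 1)
      (fun t _ => (hd t).continuousAt.continuousWithinAt)
      (fun t _ => (hd t).differentiableAt.differentiableWithinAt) fun t ht => ?_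
    rw [interior_Icc] at ht
    rw [(hd t).deriv, ← inner_sub_left]
    have h2 := hs.2 (u + t • (v - u)) u
    rw [add_sub_cancel_left, norm_smul, Real.norm_of_nonneg ht.1.le] at h2
    nlinarith [real_inner_le_norm (gradient h (u + t • (v - u)) - gradient h u) (v - u),
      mul_le_mul_of_nonneg_right h2 (norm_nonneg (v - u))]
  have := hanti (Set.left_mem_Icc.2 zero_le_one) (Set.right_mem_Icc.2 zero_le_one) zero_le_one
  simp only [zero_smul, one_smul, add_zero, add_sub_cancel] at this
  linarith

theorem StronglyConvex.add_inner_le {d : ℕ} {μ : ℝ} (hμ : 0 < μ) {h : Model d → ℝ}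
    (hc : StronglyConvex μ h) (u v : Model d) :
    h u + inner ℝ (gradient h u) (v - u) ≤ h v := by
  have := hc.2 u v
  have : 0 ≤ μ / 2 * ‖v - u‖ ^ 2 := by positivity
  linarith

/-- Co-coercivity: compare the quadratic upper bound at `v` with the supporting hyperplane at `u`,
both at the point `v - L⁻¹ • (∇h(v) - ∇h(u))`, a gradient step from `v` on `h - ⟨∇h(u), ·⟩`. -/
theorem sq_norm_gradient_sub_le {d : ℕ} {μ L : ℝ} (hμ : 0 < μ) (hL : 0 < L) {h : Model d → ℝ}
    (hs : Smooth L h) (hc : StronglyConvex μ h) (u v : Model d) :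
    ‖gradient h u - gradient h v‖ ^ 2
      ≤ 2 * L * (h v - h u - inner ℝ (gradient h u) (v - u)) := by
  set g := gradient h v - gradient h u with hg
  have h1 := hs.le_quadratic v (v - L⁻¹ • g)
  have h2 := hc.add_inner_le hμ u (v - L⁻¹ • g)
  have e1 : v - L⁻¹ • g - v = -(L⁻¹ • g) := by abel
  have e2 : v - L⁻¹ • g - u = (v - u) - L⁻¹ • g := by abel
  rw [e1, inner_neg_right, norm_neg, norm_smul, real_inner_smul_right, Real.norm_of_nonneg
    (inv_nonneg.2 hL.le)] at h1
  rw [e2, inner_sub_right, real_inner_smul_right] at h2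
  have e3 : inner ℝ (gradient h v) g - inner ℝ (gradient h u) g = ‖g‖ ^ 2 := by
    rw [← inner_sub_left, ← hg, real_inner_self_eq_norm_sq]
  have e4 : L / 2 * (L⁻¹ * ‖g‖) ^ 2 = L⁻¹ / 2 * ‖g‖ ^ 2 := by field_simp
  rw [e4] at h1
  have h3 : L⁻¹ / 2 * ‖g‖ ^ 2 ≤ h v - h u - inner ℝ (gradient h u) (v - u) := by
    have : L⁻¹ * inner ℝ (gradient h v) g - L⁻¹ * inner ℝ (gradient h u) g = L⁻¹ * ‖g‖ ^ 2 := by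
      rw [← mul_sub, e3]
    linarith
  rw [norm_sub_rev, ← hg]
  have h4 := mul_le_mul_of_nonneg_left h3 (by positivity : 0 ≤ 2 * L)
  have e5 : 2 * L * (L⁻¹ / 2 * ‖g‖ ^ 2) = ‖g‖ ^ 2 := by field_simp
  linarith

/-- The lower and upper quadratic bounds are compared at a unit vector, which exists because `1 ≤
d`. Needed for `min L lam / μ ≥ 1` in the communication bound. -/
theorem StronglyConvex.le_of_smooth {d : ℕ} (hd : 1 ≤ d) {μ L : ℝ} {h : Model d → ℝ}
    (hc : StronglyConvex μ h) (hs : Smooth L h) : μ ≤ L := by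
  have h1 := hc.2 0 (EuclideanSpace.single ⟨0, hd⟩ 1)
  have h2 := hs.le_quadratic 0 (EuclideanSpace.single ⟨0, hd⟩ 1)
  simp only [sub_zero, PiLp.norm_single, norm_one, one_pow, mul_one] at h1 h2
  linarith

/-! ### The local losses and the penalty -/

theorem gradient_localLoss {n m d : ℕ} {ft : Fin n → Fin m → Model d → ℝ}
    (hft : ∀ i j, Differentiable ℝ (ft i j)) (i : Fin n) (u : Model d) :
    gradient (localLoss ft i) u = (1 / (m : ℝ)) • ∑ j, gradient (ft i j) u := by
  refine HasGradientAt.gradient ?_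
  rw [hasGradientAt_iff_hasFDerivAt]
  have h1 : HasFDerivAt (localLoss ft i) ((1 / (m : ℝ)) • ∑ j, fderiv ℝ (ft i j) u) u :=
    (HasFDerivAt.fun_sum fun j _ => (hft i j u).hasFDerivAt).const_mul (1 / (m : ℝ))
  have e : InnerProductSpace.toDual ℝ (Model d) ((1 / (m : ℝ)) • ∑ j, gradient (ft i j) u)
      = (1 / (m : ℝ)) • ∑ j, fderiv ℝ (ft i j) u := by
    simp [map_sum]
  rw [e]
  exact h1

theorem mean_sub {n d : ℕ} (x y : Joint n d) : mean (x - y) = mean x - mean y := by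
  simp [mean, Finset.sum_sub_distrib, smul_sub]

theorem sum_sub_mean {n d : ℕ} (hn : 1 ≤ n) (x : Joint n d) : ∑ i, (x i - mean x) = 0 := by
  have : (n : ℝ) ≠ 0 := by positivity
  simp [mean, Finset.sum_sub_distrib, ← Nat.cast_smul_eq_nsmul ℝ, smul_smul, this]

theorem sum_inner_sub_mean {n d : ℕ} (hn : 1 ≤ n) (x v : Joint n d) :
    ∑ i, inner ℝ (x i - mean x) (v i) = ∑ i, inner ℝ (x i - mean x) (v i - mean v) := by
  simp only [inner_sub_right (_ : Model d) (v _) (mean v), Finset.sum_sub_distrib]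
  rw [← sum_inner, sum_sub_mean hn]
  simp

theorem sum_sq_norm_sub_mean_le {n d : ℕ} (hn : 1 ≤ n) (x : Joint n d) :
    ∑ i, ‖x i - mean x‖ ^ 2 ≤ ‖x‖ ^ 2 := by
  have h1 := sum_inner_sub_mean hn x x
  simp only [real_inner_self_eq_norm_sq] at h1
  rw [PiLp.norm_sq_eq_of_L2]
  have h2 : ∑ i, inner ℝ (x i - mean x) (x i) ≤ ∑ i, (‖x i - mean x‖ ^ 2 + ‖x i‖ ^ 2) / 2 :=
    Finset.sum_le_sum fun i _ => by
      nlinarith [real_inner_le_norm (x i - mean x) (x i), sq_nonneg (‖x i - mean x‖ - ‖x i‖)]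
  rw [← Finset.sum_div, Finset.sum_add_distrib] at h2
  linarith

theorem penalty_nonneg {n d : ℕ} (x : Joint n d) : 0 ≤ penalty x := by
  unfold penalty; positivity

/-- The penalty is a quadratic form, so its second-order expansion is exact; the mean drops out of
the linear term since centred vectors sum to zero. -/
theorem penalty_eq_add {n d : ℕ} (hn : 1 ≤ n) (x y : Joint n d) :
    penalty y = penalty x + 1 / (n : ℝ) * ∑ i, inner ℝ (x i - mean x) ((y - x) i)
      + penalty (y - x) := by
  rw [sum_inner_sub_mean hn]
  simp only [penalty, Finset.mul_sum, ← Finset.sum_add_distrib, mean_sub, PiLp.sub_apply]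
  refine Finset.sum_congr rfl fun i _ => ?_
  have e : y i - mean y = (x i - mean x) + (y i - x i - (mean y - mean x)) := by abel
  rw [e, norm_add_sq_real]
  field_simp

/-! ### The objective -/

/-- The gradient of the objective. -/
def objGrad {n m d : ℕ} (ft : Fin n → Fin m → Model d → ℝ) (lam : ℝ) (x : Joint n d) : Joint n d :=
  WithLp.toLp 2 fun i : Fin n =>
    (1 / (n : ℝ)) • gradient (localLoss ft i) (x i) + (lam / (n : ℝ)) • (x i - mean x)

/-- The Bregman distance of `h` from `u` to `v`. -/
def bregman {d : ℕ} (h : Model d → ℝ) (u v : Model d) : ℝ :=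
  h v - h u - inner ℝ (gradient h u) (v - u)

/-- The remainder is kept as an identity because the second-moment bound must match its loss and
penalty parts separately; the smoothness and strong convexity bounds also follow from it. -/
theorem objective_eq_add {n m d : ℕ} (hn : 1 ≤ n) {ft : Fin n → Fin m → Model d → ℝ}
    (hft : ∀ i j, Differentiable ℝ (ft i j)) (lam : ℝ) (x y : Joint n d) :
    objective ft lam y = objective ft lam x + inner ℝ (objGrad ft lam x) (y - x)
      + (1 / (n : ℝ) * ∑ i, 1 / (m : ℝ) * ∑ j, bregman (ft i j) (x i) (y i)
        + lam * penalty (y - x)) := by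
  have e1 : inner ℝ (objGrad ft lam x) (y - x)
      = 1 / (n : ℝ) * ∑ i, 1 / (m : ℝ) * ∑ j, inner ℝ (gradient (ft i j) (x i)) (y i - x i)
        + lam * (1 / (n : ℝ) * ∑ i, inner ℝ (x i - mean x) ((y - x) i)) := by
    rw [PiLp.inner_apply]
    simp only [objGrad, inner_add_left, real_inner_smul_left, gradient_localLoss hft, sum_inner,
      Finset.sum_add_distrib, Finset.mul_sum, PiLp.sub_apply]
    congr 1
    exact Finset.sum_congr rfl fun i _ => by ring
  simp only [objective, localLoss, bregman, penalty_eq_add hn x y, e1, Finset.sum_sub_distrib,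
    mul_sub]
  ring

theorem objective_le_quadratic {n m d : ℕ} (hn : 1 ≤ n) (hm : 1 ≤ m)
    {ft : Fin n → Fin m → Model d → ℝ} {L lam : ℝ} (hlam : 0 < lam)
    (hs : ∀ i j, Smooth L (ft i j)) (x y : Joint n d) :
    objective ft lam y ≤ objective ft lam x + inner ℝ (objGrad ft lam x) (y - x)
      + (lam + L) / n / 2 * ‖y - x‖ ^ 2 := by
  have hn' : (n : ℝ) ≠ 0 := by positivity
  have hm' : (m : ℝ) ≠ 0 := by positivity
  rw [objective_eq_add hn (fun i j => (hs i j).1) lam x y]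
  have h1 : 1 / (n : ℝ) * ∑ i, 1 / (m : ℝ) * ∑ j, bregman (ft i j) (x i) (y i)
      ≤ 1 / (n : ℝ) * ∑ i, 1 / (m : ℝ) * ∑ _j : Fin m, L / 2 * ‖(y - x) i‖ ^ 2 := by
    gcongr with i _ j _
    have := (hs i j).le_quadratic (x i) (y i)
    simp only [bregman, PiLp.sub_apply]
    linarith
  have e1 : 1 / (n : ℝ) * ∑ i, 1 / (m : ℝ) * ∑ _j : Fin m, L / 2 * ‖(y - x) i‖ ^ 2
      = L / n / 2 * ‖y - x‖ ^ 2 := by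
    simp only [Finset.sum_const, Finset.card_univ, Fintype.card_fin, nsmul_eq_mul,
      PiLp.norm_sq_eq_of_L2, Finset.mul_sum]
    exact Finset.sum_congr rfl fun i _ => by field_simp
  have h2 : lam * penalty (y - x) ≤ lam / n / 2 * ‖y - x‖ ^ 2 := by
    have := mul_le_mul_of_nonneg_left (sum_sq_norm_sub_mean_le hn (y - x))
      (by positivity : 0 ≤ lam / n / 2)
    refine le_of_eq_of_le ?_ this
    simp only [penalty]
    field_simp
  have e2 : (lam + L) / n / 2 * ‖y - x‖ ^ 2
      = L / n / 2 * ‖y - x‖ ^ 2 + lam / n / 2 * ‖y - x‖ ^ 2 := by ring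
  linarith

theorem le_objective {n m d : ℕ} (hn : 1 ≤ n) (hm : 1 ≤ m)
    {ft : Fin n → Fin m → Model d → ℝ} {μ lam : ℝ} (hlam : 0 < lam)
    (hc : ∀ i j, StronglyConvex μ (ft i j)) (x y : Joint n d) :
    objective ft lam x + inner ℝ (objGrad ft lam x) (y - x) + μ / n / 2 * ‖y - x‖ ^ 2
      ≤ objective ft lam y := by
  have hn' : (n : ℝ) ≠ 0 := by positivity
  have hm' : (m : ℝ) ≠ 0 := by positivity
  rw [objective_eq_add hn (fun i j => (hc i j).1) lam x y]
  have h1 : 1 / (n : ℝ) * ∑ i, 1 / (m : ℝ) * ∑ _j : Fin m, μ / 2 * ‖(y - x) i‖ ^ 2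
      ≤ 1 / (n : ℝ) * ∑ i, 1 / (m : ℝ) * ∑ j, bregman (ft i j) (x i) (y i) := by
    gcongr with i _ j _
    have := (hc i j).2 (x i) (y i)
    simp only [bregman, PiLp.sub_apply]
    linarith
  have e1 : 1 / (n : ℝ) * ∑ i, 1 / (m : ℝ) * ∑ _j : Fin m, μ / 2 * ‖(y - x) i‖ ^ 2
      = μ / n / 2 * ‖y - x‖ ^ 2 := by
    simp only [Finset.sum_const, Finset.card_univ, Fintype.card_fin, nsmul_eq_mul,
      PiLp.norm_sq_eq_of_L2, Finset.mul_sum]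
    exact Finset.sum_congr rfl fun i _ => by field_simp
  have h2 := mul_nonneg hlam.le (penalty_nonneg (y - x))
  linarith

/-! ### Expectations of functions of finitely valued random variables -/

section FiniteValued

variable {Ω : Type*} [MeasurableSpace Ω] {P : Measure Ω} [IsProbabilityMeasure P]
  {D : Type*} [MeasurableSpace D] [DiscreteMeasurableSpace D] [Finite D]

theorem integrable_comp_of_finite {X : Ω → D} (hX : Measurable X) (φ : D → ℝ) :
    Integrable (fun ω => φ (X ω)) P := by
  have := Measure.isProbabilityMeasure_map (μ := P) hX.aemeasurable
  exact (Integrable.of_finite (μ := P.map X) (f := φ)).comp_measurable hX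

theorem integral_comp_of_fintype {E : Type*} [MeasurableSpace E] [DiscreteMeasurableSpace E]
    [Fintype E] {X : Ω → E} (hX : Measurable X) (φ : E → ℝ) :
    ∫ ω, φ (X ω) ∂P = ∑ e, P.real {ω | X ω = e} * φ e := by
  have := Measure.isProbabilityMeasure_map (μ := P) hX.aemeasurable
  rw [← integral_map (φ := X) hX.aemeasurable
    (Measurable.of_discrete (f := φ)).aestronglyMeasurable, integral_fintype Integrable.of_finite]
  refine Finset.sum_congr rfl fun e _ => ?_
  rw [map_measureReal_apply hX (measurableSet_singleton e), smul_eq_mul]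
  rfl

/-- Fubini's theorem for a pair of independent, finitely valued random variables. -/
theorem integral_comp_of_indepFun {E : Type*} [MeasurableSpace E] [DiscreteMeasurableSpace E]
    [Finite E] {X : Ω → E} {Y : Ω → D} (hX : Measurable X) (hY : Measurable Y)
    (h : IndepFun X Y P) (φ : E → D → ℝ) :
    ∫ ω, φ (X ω) (Y ω) ∂P = ∫ ω, ∫ ω', φ (X ω) (Y ω') ∂P ∂P := by
  have := Measure.isProbabilityMeasure_map (μ := P) hX.aemeasurable
  have := Measure.isProbabilityMeasure_map (μ := P) hY.aemeasurable
  have hpair := (indepFun_iff_map_prod_eq_prod_map_map hX.aemeasurable hY.aemeasurable).1 h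
  have hφ : Measurable (Function.uncurry φ) := Measurable.of_discrete
  calc ∫ ω, φ (X ω) (Y ω) ∂P
      = ∫ q, Function.uncurry φ q ∂(P.map fun ω => (X ω, Y ω)) :=
        (integral_map (hX.prodMk hY).aemeasurable hφ.aestronglyMeasurable).symm
    _ = ∫ e, ∫ y, φ e y ∂(P.map Y) ∂(P.map X) := by
        rw [hpair, integral_prod _ Integrable.of_finite]
        rfl
    _ = ∫ ω, ∫ y, φ (X ω) y ∂(P.map Y) ∂P :=
        integral_map hX.aemeasurable
          (Measurable.of_discrete (f := fun e => ∫ y, φ e y ∂(P.map Y))).aestronglyMeasurable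
    _ = ∫ ω, ∫ ω', φ (X ω) (Y ω') ∂P ∂P := by
        congr 1 with ω
        exact integral_map hY.aemeasurable
          (Measurable.of_discrete (f := φ (X ω))).aestronglyMeasurable

theorem integral_comp_bool {X : Ω → Bool} (hX : Measurable X) {q : ℝ}
    (hq : P.real {ω | X ω = true} = q) (φ : Bool → ℝ) :
    ∫ ω, φ (X ω) ∂P = q * φ true + (1 - q) * φ false := by
  have hf : P.real {ω | X ω = false} = 1 - q := by
    rw [← hq]
    refine Eq.trans ?_ (probReal_compl_eq_one_sub (hX (measurableSet_singleton true)))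
    congr 1
    ext ω
    simp
  rw [integral_comp_of_fintype hX, Fintype.sum_bool, hq, hf]

end FiniteValued

namespace IsSampling

theorem measurable_draw {Ω : Type*} [MeasurableSpace Ω] {P : Measure Ω} {n m : ℕ} {p ρ : ℝ}
    {agg refresh : ℕ → Ω → Bool} {idx : ℕ → Ω → Fin n → Fin m}
    (hS : IsSampling P p ρ agg refresh idx) (k : ℕ) :
    Measurable fun ω => (agg k ω, refresh k ω, idx k ω) :=
  (hS.measurable_agg k).prodMk ((hS.measurable_refresh k).prodMk (hS.measurable_idx k))

variable {Ω : Type*} [MeasurableSpace Ω] {P : Measure Ω} [IsProbabilityMeasure P] {n m : ℕ}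
  {p ρ : ℝ} {agg refresh : ℕ → Ω → Bool} {idx : ℕ → Ω → Fin n → Fin m}

theorem integral_draw (hS : IsSampling P p ρ agg refresh idx) (k : ℕ)
    (φ : Bool → Bool → (Fin n → Fin m) → ℝ) :
    ∫ ω, φ (agg k ω) (refresh k ω) (idx k ω) ∂P
      = p * ∫ ω, (ρ * φ true true (idx k ω) + (1 - ρ) * φ true false (idx k ω)) ∂P
        + (1 - p) * ∫ ω, (ρ * φ false true (idx k ω) + (1 - ρ) * φ false false (idx k ω)) ∂P := by
  have hr := hS.measurable_refresh k
  have hi := hS.measurable_idx k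
  have h1 : ∀ a, ∫ ω, φ a (refresh k ω) (idx k ω) ∂P
      = ∫ ω, (ρ * φ a true (idx k ω) + (1 - ρ) * φ a false (idx k ω)) ∂P := fun a => by
    rw [integral_comp_of_indepFun hr hi (hS.indep_refresh k) (φ a),
      integral_comp_bool hr (hS.prob_refresh k) (fun r => ∫ ω', φ a r (idx k ω') ∂P),
      integral_add, integral_const_mul, integral_const_mul]
    · exact (integrable_comp_of_finite hi (φ a true)).const_mul _
    · exact (integrable_comp_of_finite hi (φ a false)).const_mul _
  rw [← h1, ← h1]
  rw [integral_comp_of_indepFun (hS.measurable_agg k) (hr.prodMk hi) (hS.indep_agg k)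
      (fun a q => φ a q.1 q.2),
    integral_comp_bool (hS.measurable_agg k) (hS.prob_agg k)
      (fun a => ∫ ω', φ a (refresh k ω') (idx k ω') ∂P)]

theorem integral_idx (hS : IsSampling P p ρ agg refresh idx) (k : ℕ) (i : Fin n)
    (φ : Fin m → ℝ) : ∫ ω, φ (idx k ω i) ∂P = 1 / (m : ℝ) * ∑ j, φ j := by
  refine (integral_comp_of_fintype
    ((measurable_pi_apply i).comp (hS.measurable_idx k)) φ).trans ?_
  rw [Finset.mul_sum]
  exact Finset.sum_congr rfl fun j _ => by rw [← hS.prob_idx k i j]; rfl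

end IsSampling

/-! ### The gradient estimator -/

theorem inner_eq_sum {n d : ℕ} (x v : Joint n d) : inner ℝ x v = ∑ i, inner ℝ (x i) (v i) :=
  PiLp.inner_apply x v

theorem norm_sq_eq_sum {n d : ℕ} (x : Joint n d) : ‖x‖ ^ 2 = ∑ i, ‖x i‖ ^ 2 :=
  PiLp.norm_sq_eq_of_L2 _ x


/-- The deviation of the gradient estimator from the gradient of the objective at the reference
point. -/
def estDev {n m d : ℕ} (ft : Fin n → Fin m → Model d → ℝ) (lam p : ℝ) (agg : Bool)
    (idx : Fin n → Fin m) (x w : Joint n d) : Joint n d :=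
  WithLp.toLp 2 fun i : Fin n =>
    if agg then (lam / ((n : ℝ) * p)) • ((x - w) i - mean (x - w))
    else (1 / ((n : ℝ) * (1 - p))) •
      (gradient (ft i (idx i)) (x i) - gradient (ft i (idx i)) (w i))

/-- Both branches share the reference gradient `∇F(w)`, so all randomness sits in the deviation. -/
theorem gradEst_eq {n m d : ℕ} (ft : Fin n → Fin m → Model d → ℝ) (lam p : ℝ) (agg : Bool)
    (idx : Fin n → Fin m) (x w : Joint n d) :
    gradEst ft lam p agg idx x w = objGrad ft lam w + estDev ft lam p agg idx x w := by
  ext1 i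
  cases agg
  · simp only [gradEst, objGrad, estDev, PiLp.add_apply, Bool.false_eq_true, if_false]
    abel
  · simp only [gradEst, objGrad, estDev, PiLp.add_apply, if_true, mean_sub, PiLp.sub_apply]
    module

section Estimator

variable {Ω : Type*} [MeasurableSpace Ω] {P : Measure Ω} [IsProbabilityMeasure P] {n m d : ℕ}
  {p ρ μ L lam : ℝ} {agg refresh : ℕ → Ω → Bool} {idx : ℕ → Ω → Fin n → Fin m}
  {ft : Fin n → Fin m → Model d → ℝ}

/-- The factors `1 / p` and `1 / (1 - p)` cancel the coin probabilities. An inner product is a sum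
over clients, so only the marginal law of each index enters. -/
theorem expect_inner_estDev (hS : IsSampling P p ρ agg refresh idx) (hp : 0 < p) (hp1 : p < 1)
    (hft : ∀ i j, Differentiable ℝ (ft i j)) (k : ℕ) (x w v : Joint n d) :
    p * ∫ ω, inner ℝ (estDev ft lam p true (idx k ω) x w) v ∂P
        + (1 - p) * ∫ ω, inner ℝ (estDev ft lam p false (idx k ω) x w) v ∂P
      = inner ℝ (objGrad ft lam x - objGrad ft lam w) v := by
  have hp1' : 1 - p ≠ 0 := by linarith
  have hi := hS.measurable_idx k
  have e1 : ∫ ω, inner ℝ (estDev ft lam p false (idx k ω) x w) v ∂P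
      = ∑ i, 1 / ((n : ℝ) * (1 - p)) * inner ℝ
          (gradient (localLoss ft i) (x i) - gradient (localLoss ft i) (w i)) (v i) := by
    simp only [inner_eq_sum, estDev, Bool.false_eq_true, if_false]
    rw [integral_finsetSum _ fun i _ => integrable_comp_of_finite hi (fun J => inner ℝ
      ((1 / ((n : ℝ) * (1 - p))) • (gradient (ft i (J i)) (x i) - gradient (ft i (J i)) (w i)))
      (v i))]
    refine Finset.sum_congr rfl fun i _ => ?_
    rw [hS.integral_idx k i fun j => inner ℝ
      ((1 / ((n : ℝ) * (1 - p))) • (gradient (ft i j) (x i) - gradient (ft i j) (w i))) (v i)]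
    simp only [gradient_localLoss hft, ← smul_sub, ← Finset.sum_sub_distrib, real_inner_smul_left,
      sum_inner, ← Finset.mul_sum]
    ring
  have e2 : ∀ J, inner ℝ (estDev ft lam p true J x w) v
      = ∑ i, lam / ((n : ℝ) * p) * inner ℝ ((x - w) i - mean (x - w)) (v i) := fun J => by
    simp only [inner_eq_sum, estDev, if_true, real_inner_smul_left]
  rw [e1, inner_eq_sum (objGrad ft lam x - objGrad ft lam w) v]
  simp only [e2, integral_const, probReal_univ, one_smul, Finset.mul_sum,
    ← Finset.sum_add_distrib, objGrad, PiLp.sub_apply]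
  refine Finset.sum_congr rfl fun i _ => ?_
  rw [mean_sub]
  simp only [inner_sub_left, inner_add_left, real_inner_smul_left]
  field_simp
  ring

/-- The local branch is bounded by co-coercivity of each summand and the aggregation branch is
exactly a multiple of the penalty. The chosen `p` gives both the factor `2 (lam + L) / n`, so they
add up to the Bregman distance of `F`. -/
theorem expect_sq_norm_estDev_le (hS : IsSampling P p ρ agg refresh idx) (hn : 1 ≤ n)
    (hμ : 0 < μ) (hL : 0 < L) (hlam : 0 < lam) (hp : p = lam / (lam + L))
    (hs : ∀ i j, Smooth L (ft i j)) (hc : ∀ i j, StronglyConvex μ (ft i j)) (k : ℕ)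
    (x w : Joint n d) :
    p * ∫ ω, ‖estDev ft lam p true (idx k ω) x w‖ ^ 2 ∂P
        + (1 - p) * ∫ ω, ‖estDev ft lam p false (idx k ω) x w‖ ^ 2 ∂P
      ≤ 2 * ((lam + L) / n) *
        (objective ft lam w - objective ft lam x - inner ℝ (objGrad ft lam x) (w - x)) := by
  have hn' : (n : ℝ) ≠ 0 := by positivity
  have hp1 : 1 - p = L / (lam + L) := by rw [hp]; field_simp; ring
  have hi := hS.measurable_idx k
  have e1 : ∫ ω, ‖estDev ft lam p false (idx k ω) x w‖ ^ 2 ∂P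
      = ((lam + L) / (n * L)) ^ 2 * ∑ i, 1 / (m : ℝ) * ∑ j,
        ‖gradient (ft i j) (x i) - gradient (ft i j) (w i)‖ ^ 2 := by
    simp only [norm_sq_eq_sum, estDev, Bool.false_eq_true, if_false]
    rw [integral_finsetSum _ fun i _ => integrable_comp_of_finite hi (fun J =>
      ‖(1 / ((n : ℝ) * (1 - p))) •
        (gradient (ft i (J i)) (x i) - gradient (ft i (J i)) (w i))‖ ^ 2), Finset.mul_sum]
    refine Finset.sum_congr rfl fun i _ => ?_
    rw [hS.integral_idx k i fun j => ‖(1 / ((n : ℝ) * (1 - p))) •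
      (gradient (ft i j) (x i) - gradient (ft i j) (w i))‖ ^ 2]
    simp only [norm_smul, mul_pow, ← Finset.mul_sum, Real.norm_eq_abs, sq_abs, hp1]
    field_simp
  have e2 : ∀ J, ‖estDev ft lam p true J x w‖ ^ 2
      = ((lam + L) / n) ^ 2 * (2 * n * penalty (w - x)) := fun J => by
    simp only [norm_sq_eq_sum, estDev, if_true, norm_smul, mul_pow, ← Finset.mul_sum,
      Real.norm_eq_abs, sq_abs, penalty]
    have : ∀ i, ‖(x - w) i - mean (x - w)‖ = ‖(w - x) i - mean (w - x)‖ := fun i => by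
      rw [mean_sub, mean_sub, PiLp.sub_apply, PiLp.sub_apply, ← norm_neg]
      congr 1
      abel
    simp only [this, hp]
    field_simp
  have h1 : ∑ i, 1 / (m : ℝ) * ∑ j, ‖gradient (ft i j) (x i) - gradient (ft i j) (w i)‖ ^ 2
      ≤ 2 * L * ∑ i, 1 / (m : ℝ) * ∑ j, bregman (ft i j) (x i) (w i) := by
    simp only [Finset.mul_sum]
    refine Finset.sum_le_sum fun i _ => Finset.sum_le_sum fun j _ => ?_
    have := mul_le_mul_of_nonneg_left (sq_norm_gradient_sub_le hμ hL (hs i j) (hc i j) (x i) (w i))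
      (by positivity : 0 ≤ 1 / (m : ℝ))
    rw [bregman]
    linarith
  have h2 := mul_le_mul_of_nonneg_left h1
    (by positivity : 0 ≤ L / (lam + L) * ((lam + L) / (n * L)) ^ 2)
  rw [objective_eq_add hn (fun i j => (hs i j).1) lam x w]
  simp only [e1, e2, integral_const, probReal_univ, one_smul, hp1]
  rw [← mul_assoc (L / (lam + L))]
  refine (add_le_add_right h2 _).trans (le_of_eq ?_)
  rw [hp]
  field_simp
  ring

theorem expect_inner_gradEst (hS : IsSampling P p ρ agg refresh idx) (hp : 0 < p) (hp1 : p < 1)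
    (hft : ∀ i j, Differentiable ℝ (ft i j)) (k : ℕ) (x w v : Joint n d) :
    p * ∫ ω, inner ℝ (gradEst ft lam p true (idx k ω) x w) v ∂P
        + (1 - p) * ∫ ω, inner ℝ (gradEst ft lam p false (idx k ω) x w) v ∂P
      = inner ℝ (objGrad ft lam x) v := by
  have hi := hS.measurable_idx k
  have h := expect_inner_estDev (lam := lam) hS hp hp1 hft k x w v
  have hint : ∀ b, Integrable (fun ω => inner ℝ (estDev ft lam p b (idx k ω) x w) v) P := fun b =>
    integrable_comp_of_finite hi fun J => inner ℝ (estDev ft lam p b J x w) v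
  simp only [gradEst_eq, inner_add_left]
  rw [integral_add (integrable_const _) (hint true), integral_add (integrable_const _) (hint false)]
  simp only [integral_const, probReal_univ, one_smul]
  rw [inner_sub_left] at h
  linarith

theorem expect_sq_norm_gradEst_le (hS : IsSampling P p ρ agg refresh idx) (hn : 1 ≤ n)
    (hμ : 0 < μ) (hL : 0 < L) (hlam : 0 < lam) (hp : p = lam / (lam + L))
    (hs : ∀ i j, Smooth L (ft i j)) (hc : ∀ i j, StronglyConvex μ (ft i j)) (k : ℕ)
    (x w : Joint n d) :
    p * ∫ ω, ‖gradEst ft lam p true (idx k ω) x w‖ ^ 2 ∂P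
        + (1 - p) * ∫ ω, ‖gradEst ft lam p false (idx k ω) x w‖ ^ 2 ∂P
      ≤ ‖objGrad ft lam x‖ ^ 2 + 2 * ((lam + L) / n) *
        (objective ft lam w - objective ft lam x - inner ℝ (objGrad ft lam x) (w - x)) := by
  have hi := hS.measurable_idx k
  have hp0 : 0 < p := by rw [hp]; positivity
  have hp1 : p < 1 := by rw [hp, div_lt_one (by positivity)]; linarith
  have h := expect_inner_estDev (lam := lam) hS hp0 hp1 (fun i j => (hs i j).1) k x w
    (objGrad ft lam w)
  have h' := expect_sq_norm_estDev_le hS hn hμ hL hlam hp hs hc k x w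
  have hint : ∀ b, Integrable (fun ω => ‖estDev ft lam p b (idx k ω) x w‖ ^ 2) P := fun b =>
    integrable_comp_of_finite hi fun J => ‖estDev ft lam p b J x w‖ ^ 2
  have hint' : ∀ b, Integrable (fun ω =>
      2 * inner ℝ (estDev ft lam p b (idx k ω) x w) (objGrad ft lam w)) P := fun b =>
    integrable_comp_of_finite hi fun J => 2 * inner ℝ (estDev ft lam p b J x w) (objGrad ft lam w)
  have e : ∀ b, ∫ ω, ‖gradEst ft lam p b (idx k ω) x w‖ ^ 2 ∂P
      = ‖objGrad ft lam w‖ ^ 2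
        + 2 * ∫ ω, inner ℝ (estDev ft lam p b (idx k ω) x w) (objGrad ft lam w) ∂P
        + ∫ ω, ‖estDev ft lam p b (idx k ω) x w‖ ^ 2 ∂P := fun b => by
    simp only [gradEst_eq, norm_add_sq_real, real_inner_comm (estDev _ _ _ _ _ _ _)]
    rw [integral_add (f := fun ω => ‖objGrad ft lam w‖ ^ 2
        + 2 * inner ℝ (estDev ft lam p b (idx k ω) x w) (objGrad ft lam w))
        ((integrable_const _).add (hint' b)) (hint b),
      integral_add (integrable_const _) (hint' b), integral_const_mul]
    simp only [integral_const, probReal_univ, one_smul]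
  -- Unbiasedness gives second moment `‖∇F(x)‖² - ‖∇F(x) - ∇F(w)‖²` plus that of the deviation; the
  -- negative square is dropped.
  have hsq := norm_sub_sq_real (objGrad ft lam x) (objGrad ft lam w)
  have hnn := sq_nonneg ‖objGrad ft lam x - objGrad ft lam w‖
  rw [inner_sub_left, real_inner_self_eq_norm_sq] at h
  rw [e, e]
  linarith

end Estimator

/-! ### One iteration of the algorithm -/

/-- The relations between the parameters on which the convergence proof rests; `σ` is the strong
convexity constant of the objective and `M` its smoothness constant. -/
structure Admissible (σ M : ℝ) (a : Params) : Prop where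
  rho_pos : 0 < a.ρ
  rho_le : a.ρ ≤ 1
  smooth_pos : 0 < M
  eta_eq : a.η = 1 / (4 * M)
  theta_two : a.θ₂ = 1 / 2
  theta_one_pos : 0 < a.θ₁
  theta_one_le : a.θ₁ ≤ 1 / 2
  gamma_pos : 0 < a.γ
  gamma_le : a.γ * a.θ₁ ≤ a.η / 4
  beta_eq : a.β = 1 - a.γ * σ
  half_le_beta : 1 / 2 ≤ a.β
  rate_le : a.ρ * a.θ₁ / 2 ≤ a.γ * σ

theorem Admissible.eta_mul {σ M : ℝ} {a : Params} (ha : Admissible σ M a) : a.η * M = 1 / 4 := by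
  have := ha.smooth_pos
  rw [ha.eta_eq]
  field_simp

/-- A Lyapunov function equivalent to `lyapunov` that contracts in every iteration. -/
def potential {n m d : ℕ} (ft : Fin n → Fin m → Model d → ℝ) (lam : ℝ) (a : Params)
    (xs : Joint n d) (s : State n d) : ℝ :=
  ‖s.z - xs‖ ^ 2
    + (1 - a.θ₁) * a.γ * a.β / a.θ₁ * (objective ft lam s.y - objective ft lam xs)
    + (1 + a.θ₁) * a.γ * a.β / (a.θ₁ * a.ρ) * (objective ft lam s.w - objective ft lam xs)

section Comparison

variable {n m d : ℕ} {ft : Fin n → Fin m → Model d → ℝ} {lam σ M : ℝ} {a : Params}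

/-- For `θ₂ = 1 / 2` the `w`-weights coincide, and the `y`-weights compare by `1 - θ₁ ≤ 2`; the
reverse bound below uses `2 ≤ 4 (1 - θ₁)`. -/
theorem potential_le_lyapunov (ha : Admissible σ M a) {xs : Joint n d}
    (hxs : ∀ y, objective ft lam xs ≤ objective ft lam y) (s : State n d) :
    potential ft lam a xs s ≤ lyapunov ft lam a xs s := by
  have h1 := ha.theta_one_pos
  have h2 := ha.gamma_pos
  have h3 : 0 < a.β := lt_of_lt_of_le (by norm_num) ha.half_le_beta
  have hy := sub_nonneg.2 (hxs s.y)
  have e : 2 * (1 / 2 : ℝ) + a.θ₁ = 1 + a.θ₁ := by ring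
  unfold potential lyapunov
  rw [ha.theta_two, e]
  gcongr
  linarith

theorem lyapunov_le_potential (ha : Admissible σ M a) {xs : Joint n d}
    (hxs : ∀ y, objective ft lam xs ≤ objective ft lam y) (s : State n d) :
    lyapunov ft lam a xs s ≤ 4 * potential ft lam a xs s := by
  have h1 := ha.theta_one_pos
  have h2 := ha.gamma_pos
  have h3 : 0 < a.β := lt_of_lt_of_le (by norm_num) ha.half_le_beta
  have h4 := ha.rho_pos
  have hy := sub_nonneg.2 (hxs s.y)
  have hw := sub_nonneg.2 (hxs s.w)
  have e : 2 * (1 / 2 : ℝ) + a.θ₁ = 1 + a.θ₁ := by ring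
  have hB : 0 ≤ (1 + a.θ₁) * a.γ * a.β / (a.θ₁ * a.ρ)
      * (objective ft lam s.w - objective ft lam xs) := by positivity
  have hA : 2 * a.γ * a.β / a.θ₁ * (objective ft lam s.y - objective ft lam xs)
      ≤ 4 * ((1 - a.θ₁) * a.γ * a.β / a.θ₁ * (objective ft lam s.y - objective ft lam xs)) := by
    have : 2 * a.γ * a.β / a.θ₁ ≤ 4 * (1 - a.θ₁) * a.γ * a.β / a.θ₁ := by
      gcongr
      linarith [ha.theta_one_le]
    calc _ ≤ 4 * (1 - a.θ₁) * a.γ * a.β / a.θ₁ * (objective ft lam s.y - objective ft lam xs) := by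
          gcongr
      _ = _ := by ring
  have hz := sq_nonneg ‖s.z - xs‖
  unfold potential lyapunov
  rw [ha.theta_two, e]
  linarith

end Comparison

theorem sq_norm_convex_combination {E : Type*} [NormedAddCommGroup E] [InnerProductSpace ℝ E]
    (b : ℝ) (u v : E) :
    ‖b • u + (1 - b) • v‖ ^ 2 = b * ‖u‖ ^ 2 + (1 - b) * ‖v‖ ^ 2 - b * (1 - b) * ‖u - v‖ ^ 2 := by
  rw [norm_add_sq_real, norm_sub_sq_real, norm_smul, norm_smul, real_inner_smul_left,
    real_inner_smul_right, mul_pow, mul_pow, Real.norm_eq_abs, Real.norm_eq_abs, sq_abs, sq_abs]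
  ring

section OneStep

variable {n m d : ℕ} {ft : Fin n → Fin m → Model d → ℝ} {μ L lam : ℝ} {a : Params}

/-- The deterministic part of the distance of `z^{k+1}` to `xs`. -/
def drift (a : Params) (s : State n d) (xs : Joint n d) : Joint n d :=
  a.β • (s.z - xs) + (1 - a.β) • (s.x a - xs)

/-- The new `z - xs` is `drift - γ g`, and the new `y` is a gradient step; `η M = 1 / 4` turns the
quadratic term `M η² / 2` of the descent inequality into `η / 8`. -/
theorem sq_norm_step_add_le (hn : 1 ≤ n) (hm : 1 ≤ m) (hlam : 0 < lam)
    (ha : Admissible (μ / n) ((lam + L) / n) a) (hs : ∀ i j, Smooth L (ft i j)) {t : ℝ}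
    (ht : 0 ≤ t) (agg refresh : Bool) (J : Fin n → Fin m) (s : State n d) (xs : Joint n d) :
    ‖(step ft lam a agg refresh J s).z - xs‖ ^ 2 + t * objective ft lam (nextY ft lam a agg J s)
      ≤ ‖drift a s xs‖ ^ 2 + t * objective ft lam (s.x a)
        - 2 * a.γ * inner ℝ (gradEst ft lam a.p agg J (s.x a) s.w) (drift a s xs)
        - t * a.η * inner ℝ (gradEst ft lam a.p agg J (s.x a) s.w) (objGrad ft lam (s.x a))
        + (a.γ ^ 2 + t * a.η / 8) * ‖gradEst ft lam a.p agg J (s.x a) s.w‖ ^ 2 := by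
  set x := s.x a
  set g := gradEst ft lam a.p agg J x s.w with hg
  have hM := ha.smooth_pos
  have hη : a.η ≠ 0 := by rw [ha.eta_eq]; positivity
  have hz : (step ft lam a agg refresh J s).z - xs = drift a s xs - a.γ • g := by
    have : (a.γ / a.η) • (nextY ft lam a agg J s - x) = -(a.γ • g) := by
      simp only [nextY]
      rw [← hg, sub_sub_cancel_left, smul_neg, smul_smul, div_mul_cancel₀ _ hη]
    simp only [step, drift]
    rw [this]
    module
  have hy := objective_le_quadratic hn hm hlam hs x (nextY ft lam a agg J s)
  have e1 : nextY ft lam a agg J s - x = -(a.η • g) := by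
    simp only [nextY]
    rw [← hg, sub_sub_cancel_left]
  rw [e1, inner_neg_right, norm_neg, norm_smul, mul_pow, Real.norm_eq_abs, sq_abs,
    real_inner_smul_right, real_inner_comm] at hy
  have e2 : (lam + L) / n / 2 * (a.η ^ 2 * ‖g‖ ^ 2) = a.η / 8 * ‖g‖ ^ 2 := by
    linear_combination (a.η / 2 * ‖g‖ ^ 2) * ha.eta_mul
  rw [e2] at hy
  rw [hz, norm_sub_sq_real, norm_smul, mul_pow, Real.norm_eq_abs, sq_abs, real_inner_smul_right,
    real_inner_comm]
  linarith [mul_le_mul_of_nonneg_left hy ht]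

/-- The estimate of one iteration after the expectation of the gradient estimator is taken, with
`S` the second moment of the estimator. -/
theorem drift_estimate (hn : 1 ≤ n) (hm : 1 ≤ m) (hμ : 0 < μ) (hlam : 0 < lam)
    (ha : Admissible (μ / n) ((lam + L) / n) a) (hc : ∀ i j, StronglyConvex μ (ft i j))
    (s : State n d) {xs : Joint n d} (hxs : ∀ y, objective ft lam xs ≤ objective ft lam y) {S : ℝ}
    (hS : S ≤ ‖objGrad ft lam (s.x a)‖ ^ 2 + 2 * ((lam + L) / n) *
      (objective ft lam s.w - objective ft lam (s.x a)
        - inner ℝ (objGrad ft lam (s.x a)) (s.w - s.x a))) :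
    ‖drift a s xs‖ ^ 2 + 2 * a.γ * a.β / a.θ₁ * objective ft lam (s.x a)
        - 2 * a.γ * inner ℝ (objGrad ft lam (s.x a)) (drift a s xs)
        - 2 * a.γ * a.β / a.θ₁ * a.η * ‖objGrad ft lam (s.x a)‖ ^ 2
        + (a.γ ^ 2 + 2 * a.γ * a.β / a.θ₁ * a.η / 8) * S
      ≤ a.β * ‖s.z - xs‖ ^ 2 + (2 * a.γ * a.β / a.θ₁ * objective ft lam xs
        + 2 * a.γ * a.β / a.θ₁ * (1 / 2 * (objective ft lam s.w - objective ft lam xs)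
        + (1 / 2 - a.θ₁) * (objective ft lam s.y - objective ft lam xs))) := by
  have hθ := ha.theta_one_pos
  have hγ := ha.gamma_pos
  have hβ : 0 < a.β := lt_of_lt_of_le (by norm_num) ha.half_le_beta
  have hM := ha.smooth_pos
  have hσ : 0 < μ / n := by positivity
  have hη : 0 < a.η := by rw [ha.eta_eq]; positivity
  have hβ1 : 0 ≤ 1 - a.β := by rw [ha.beta_eq]; linarith [mul_pos hγ hσ]
  set x := s.x a with hx
  set G := objGrad ft lam x
  set t := 2 * a.γ * a.β / a.θ₁ with ht
  have ht0 : 0 < t := by positivity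
  have htθ : t * a.θ₁ = 2 * a.γ * a.β := by rw [ht]; field_simp
  have hD : 0 ≤ objective ft lam s.w - objective ft lam x - inner ℝ G (s.w - x) := by
    have := le_objective hn hm hlam hc x s.w
    have : 0 ≤ μ / n / 2 * ‖s.w - x‖ ^ 2 := by positivity
    linarith
  have hy : objective ft lam x + inner ℝ G (s.y - x) ≤ objective ft lam s.y := by
    have := le_objective hn hm hlam hc x s.y
    have : 0 ≤ μ / n / 2 * ‖s.y - x‖ ^ 2 := by positivity
    linarith
  have hxs' := le_objective hn hm hlam hc x xs
  have e1 : ‖xs - x‖ = ‖x - xs‖ := norm_sub_rev _ _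
  have e2 : inner ℝ G (xs - x) = -inner ℝ G (x - xs) := by rw [← inner_neg_right, neg_sub]
  rw [e1, e2] at hxs'
  have hv : ‖drift a s xs‖ ^ 2 ≤ a.β * ‖s.z - xs‖ ^ 2 + (1 - a.β) * ‖x - xs‖ ^ 2 := by
    rw [drift, sq_norm_convex_combination]
    have : 0 ≤ a.β * (1 - a.β) * ‖s.z - xs - (x - xs)‖ ^ 2 := by positivity
    linarith
  have e3 : inner ℝ G (drift a s xs) = a.β * inner ℝ G (s.z - x) + inner ℝ G (x - xs) := by
    have : drift a s xs = a.β • (s.z - x) + (x - xs) := by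
      rw [drift]
      module
    rw [this, inner_add_right, real_inner_smul_right]
  -- The definition of `x` as a convex combination, rearranged around `x`.
  have e4 : a.θ₁ * inner ℝ G (s.z - x)
      = -(1 / 2 * inner ℝ G (s.w - x)) - (1 / 2 - a.θ₁) * inner ℝ G (s.y - x) := by
    have : a.θ₁ • (s.z - x) = -((1 / 2 : ℝ) • (s.w - x)) - (1 / 2 - a.θ₁) • (s.y - x) := by
      rw [hx, State.x, ha.theta_two]
      module
    rw [← real_inner_smul_right, this, inner_sub_right, inner_neg_right, real_inner_smul_right,
      real_inner_smul_right]
  -- This makes the coefficient of the second moment at most `t η`, so that the `‖∇F(x)‖²` terms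
  -- cancel.
  have hγt : a.γ ^ 2 ≤ 7 / 8 * t * a.η := by
    have h1 : a.γ * (a.γ * a.θ₁) ≤ a.γ * (a.η / 4) := by gcongr; exact ha.gamma_le
    have h2 : a.γ * (a.η / 4) ≤ 7 / 8 * (2 * a.γ * a.β) * a.η := by
      nlinarith [mul_pos hγ hη, ha.half_le_beta]
    rw [← htθ] at h2
    nlinarith
  have hcoef : 0 ≤ a.γ ^ 2 + t * a.η / 8 := by positivity
  have h1 := mul_le_mul_of_nonneg_left hS hcoef
  have hηM := ha.eta_mul
  have h2 : (a.γ ^ 2 + t * a.η / 8) * (‖G‖ ^ 2 + 2 * ((lam + L) / n) *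
      (objective ft lam s.w - objective ft lam x - inner ℝ G (s.w - x)))
      ≤ t * a.η * (‖G‖ ^ 2 + 2 * ((lam + L) / n) *
      (objective ft lam s.w - objective ft lam x - inner ℝ G (s.w - x))) := by
    gcongr
    linarith
  have e5 : t * a.η * (‖G‖ ^ 2 + 2 * ((lam + L) / n) *
      (objective ft lam s.w - objective ft lam x - inner ℝ G (s.w - x)))
      = t * a.η * ‖G‖ ^ 2 + t / 2 *
        (objective ft lam s.w - objective ft lam x - inner ℝ G (s.w - x)) := by
    linear_combination 2 * t
      * (objective ft lam s.w - objective ft lam x - inner ℝ G (s.w - x)) * hηM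
  have e6 : 2 * a.γ * inner ℝ G (drift a s xs) = 2 * a.γ * inner ℝ G (x - xs)
      + t * (-(1 / 2 * inner ℝ G (s.w - x)) - (1 / 2 - a.θ₁) * inner ℝ G (s.y - x)) := by
    rw [e3, ← e4]
    linear_combination (-inner ℝ G (s.z - x)) * htθ
  have h3 : t * ((1 / 2 - a.θ₁) * (objective ft lam x + inner ℝ G (s.y - x)))
      ≤ t * ((1 / 2 - a.θ₁) * objective ft lam s.y) := by
    have := sub_nonneg.2 ha.theta_one_le
    gcongr
  have h4 := mul_le_mul_of_nonneg_left hxs' (by positivity : 0 ≤ 2 * a.γ)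
  -- What remains of `F(x)` has weight `t θ₁ = 2 γ β ≤ 2 γ`, and strong convexity towards `xs`
  -- absorbs it.
  have h5 : t * a.θ₁ * (objective ft lam x - objective ft lam xs)
      ≤ 2 * a.γ * (objective ft lam x - objective ft lam xs) := by
    rw [htθ]
    exact mul_le_mul_of_nonneg_right (mul_le_of_le_one_right (by positivity) (by linarith))
      (sub_nonneg.2 (hxs x))
  have e7 : (1 - a.β) * ‖x - xs‖ ^ 2 = 2 * a.γ * (μ / n / 2 * ‖x - xs‖ ^ 2) := by
    rw [ha.beta_eq]
    ring
  rw [e6]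
  linarith

end OneStep

/-! ### Linear convergence in expectation -/

/-- The three weights are compared separately: `Z` by `rate_le`, `Y` by the loss of `θ₁` in its
weight, `W` by `(1 - θ₁ / 2) (1 + θ₁) ≥ 1`. The constant `F` cancels. -/
theorem combine_coefficients {σ M : ℝ} {a : Params} (ha : Admissible σ M a) {Z Y W : ℝ}
    (hZ : 0 ≤ Z) (hY : 0 ≤ Y) (hW : 0 ≤ W) (F : ℝ) :
    a.β * Z + (F + 2 * a.γ * a.β / a.θ₁ * (1 / 2 * W + (1 / 2 - a.θ₁) * Y))
        + ((1 - a.ρ) * ((1 + a.θ₁) * a.γ * a.β / (a.θ₁ * a.ρ) * W) - F)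
      ≤ (1 - a.ρ * a.θ₁ / 2) * (Z + (1 - a.θ₁) * a.γ * a.β / a.θ₁ * Y
        + (1 + a.θ₁) * a.γ * a.β / (a.θ₁ * a.ρ) * W) := by
  have hθ := ha.theta_one_pos
  have hθ1 := ha.theta_one_le
  have hρ := ha.rho_pos
  have hρ1 := ha.rho_le
  have hγ := ha.gamma_pos
  have hβ : 0 < a.β := lt_of_lt_of_le (by norm_num) ha.half_le_beta
  set t := 2 * a.γ * a.β / a.θ₁ with ht
  have ht0 : 0 ≤ t := by positivity
  have hA : (1 - a.θ₁) * a.γ * a.β / a.θ₁ = t * (1 - a.θ₁) / 2 := by rw [ht]; field_simp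
  have hB : (1 + a.θ₁) * a.γ * a.β / (a.θ₁ * a.ρ) = t * (1 + a.θ₁) / (2 * a.ρ) := by
    rw [ht]
    field_simp
  have g1 : a.β * Z ≤ (1 - a.ρ * a.θ₁ / 2) * Z := by
    refine mul_le_mul_of_nonneg_right ?_ hZ
    rw [ha.beta_eq]
    linarith [ha.rate_le]
  have g2 : t * (1 / 2 - a.θ₁) * Y ≤ (1 - a.ρ * a.θ₁ / 2) * (t * (1 - a.θ₁) / 2) * Y := by
    refine mul_le_mul_of_nonneg_right ?_ hY
    have hρθ : a.ρ * a.θ₁ ≤ a.θ₁ := mul_le_of_le_one_left hθ.le hρ1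
    have : 1 / 2 - a.θ₁ ≤ (1 - a.ρ * a.θ₁ / 2) * ((1 - a.θ₁) / 2) := by
      nlinarith [mul_pos (mul_pos hρ hθ) hθ]
    calc t * (1 / 2 - a.θ₁) ≤ t * ((1 - a.ρ * a.θ₁ / 2) * ((1 - a.θ₁) / 2)) := by gcongr
      _ = _ := by ring
  have g3 : (t / 2 + (1 - a.ρ) * (t * (1 + a.θ₁) / (2 * a.ρ))) * W
      ≤ (1 - a.ρ * a.θ₁ / 2) * (t * (1 + a.θ₁) / (2 * a.ρ)) * W := by
    refine mul_le_mul_of_nonneg_right ?_ hW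
    have e : (1 - a.ρ * a.θ₁ / 2) * (t * (1 + a.θ₁) / (2 * a.ρ))
        = (1 - a.ρ) * (t * (1 + a.θ₁) / (2 * a.ρ))
          + t / 2 * ((1 - a.θ₁ / 2) * (1 + a.θ₁)) := by
      field_simp
      ring
    have : 1 ≤ (1 - a.θ₁ / 2) * (1 + a.θ₁) := by nlinarith
    rw [e]
    linarith [mul_le_mul_of_nonneg_left this (by positivity : 0 ≤ t / 2)]
  rw [hA, hB]
  linarith

section Contraction

variable {Ω : Type*} [MeasurableSpace Ω] {P : Measure Ω} [IsProbabilityMeasure P] {n m d : ℕ}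
  {μ L lam : ℝ} {a : Params} {agg refresh : ℕ → Ω → Bool} {idx : ℕ → Ω → Fin n → Fin m}
  {ft : Fin n → Fin m → Model d → ℝ}

theorem integral_affine {f g h : Ω → ℝ} (hf : Integrable f P) (hg : Integrable g P)
    (hh : Integrable h P) (c b₁ b₂ b₃ : ℝ) :
    ∫ ω, (c - b₁ * f ω - b₂ * g ω + b₃ * h ω) ∂P
      = c - b₁ * ∫ ω, f ω ∂P - b₂ * ∫ ω, g ω ∂P + b₃ * ∫ ω, h ω ∂P := by
  have h1 : Integrable (fun ω => c - b₁ * f ω) P := (integrable_const c).sub (hf.const_mul b₁)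
  have h2 : Integrable (fun ω => c - b₁ * f ω - b₂ * g ω) P := h1.sub (hg.const_mul b₂)
  rw [integral_add h2 (hh.const_mul b₃), integral_sub h1 (hg.const_mul b₂),
    integral_sub (integrable_const c) (hf.const_mul b₁), integral_const_mul, integral_const_mul,
    integral_const_mul, integral_const, probReal_univ, one_smul]

theorem expect_refresh_potential_le (hS : IsSampling P a.p a.ρ agg refresh idx) (hn : 1 ≤ n)
    (hm : 1 ≤ m) (hlam : 0 < lam) (ha : Admissible (μ / n) ((lam + L) / n) a)
    (hs : ∀ i j, Smooth L (ft i j)) (k : ℕ) (s : State n d) (xs : Joint n d) (b : Bool) :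
    ∫ ω, (a.ρ * potential ft lam a xs (step ft lam a b true (idx k ω) s)
        + (1 - a.ρ) * potential ft lam a xs (step ft lam a b false (idx k ω) s)) ∂P
      ≤ ‖drift a s xs‖ ^ 2
        + 2 * a.γ * a.β / a.θ₁ * (objective ft lam (s.x a) - objective ft lam xs)
        + (1 - a.ρ) * ((1 + a.θ₁) * a.γ * a.β / (a.θ₁ * a.ρ)
          * (objective ft lam s.w - objective ft lam xs))
        - 2 * a.γ * ∫ ω, inner ℝ (gradEst ft lam a.p b (idx k ω) (s.x a) s.w) (drift a s xs) ∂P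
        - 2 * a.γ * a.β / a.θ₁ * a.η *
          ∫ ω, inner ℝ (gradEst ft lam a.p b (idx k ω) (s.x a) s.w) (objGrad ft lam (s.x a)) ∂P
        + (a.γ ^ 2 + 2 * a.γ * a.β / a.θ₁ * a.η / 8) *
          ∫ ω, ‖gradEst ft lam a.p b (idx k ω) (s.x a) s.w‖ ^ 2 ∂P := by
  have hi := hS.measurable_idx k
  have hθ := ha.theta_one_pos
  have hρ := ha.rho_pos
  have hγ := ha.gamma_pos
  have hβ : 0 < a.β := lt_of_lt_of_le (by norm_num) ha.half_le_beta
  set t := 2 * a.γ * a.β / a.θ₁ with ht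
  set B := (1 + a.θ₁) * a.γ * a.β / (a.θ₁ * a.ρ) with hB
  have ht0 : 0 ≤ t := by positivity
  -- After averaging over the refresh coin the new `y` has total weight `t`, the weight used in
  -- `drift_estimate`; this fixes the weights of `potential`.
  have hAB : (1 - a.θ₁) * a.γ * a.β / a.θ₁ + a.ρ * B = t := by
    rw [ht, hB]
    field_simp
    ring
  have h1 := fun v => integrable_comp_of_finite (P := P) hi fun J =>
    inner ℝ (gradEst ft lam a.p b J (s.x a) s.w) v
  have h2 := integrable_comp_of_finite (P := P) hi fun J =>
    ‖gradEst ft lam a.p b J (s.x a) s.w‖ ^ 2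
  set c₀ := ‖drift a s xs‖ ^ 2 + t * (objective ft lam (s.x a) - objective ft lam xs)
        + (1 - a.ρ) * (B * (objective ft lam s.w - objective ft lam xs))
  have hpt : ∀ J : Fin n → Fin m, a.ρ * potential ft lam a xs (step ft lam a b true J s)
        + (1 - a.ρ) * potential ft lam a xs (step ft lam a b false J s)
      ≤ c₀ - 2 * a.γ * inner ℝ (gradEst ft lam a.p b J (s.x a) s.w) (drift a s xs)
        - t * a.η * inner ℝ (gradEst ft lam a.p b J (s.x a) s.w) (objGrad ft lam (s.x a))
        + (a.γ ^ 2 + t * a.η / 8) * ‖gradEst ft lam a.p b J (s.x a) s.w‖ ^ 2 := fun J => by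
    have h := sq_norm_step_add_le hn hm hlam ha hs ht0 b true J s xs
    simp only [potential, ← hB]
    simp only [step, if_true, Bool.false_eq_true, if_false] at h ⊢
    refine le_trans (le_of_eq ?_) (le_trans (add_le_add_left h
      ((1 - a.ρ) * (B * (objective ft lam s.w - objective ft lam xs))
        - t * objective ft lam xs)) (le_of_eq ?_))
    · linear_combination (objective ft lam (nextY ft lam a b J s) - objective ft lam xs) * hAB
    · simp only [c₀]
      ring
  refine (integral_mono (integrable_comp_of_finite hi fun J =>
    a.ρ * potential ft lam a xs (step ft lam a b true J s)
        + (1 - a.ρ) * potential ft lam a xs (step ft lam a b false J s))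
    (integrable_comp_of_finite hi fun J =>
      c₀ - 2 * a.γ * inner ℝ (gradEst ft lam a.p b J (s.x a) s.w) (drift a s xs)
        - t * a.η * inner ℝ (gradEst ft lam a.p b J (s.x a) s.w) (objGrad ft lam (s.x a))
        + (a.γ ^ 2 + t * a.η / 8) * ‖gradEst ft lam a.p b J (s.x a) s.w‖ ^ 2)
    fun ω => hpt (idx k ω)).trans (le_of_eq ?_)
  exact integral_affine (h1 _) (h1 _) h2 _ _ _ _

theorem expect_step_potential_le (hS : IsSampling P a.p a.ρ agg refresh idx) (hn : 1 ≤ n)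
    (hm : 1 ≤ m) (hμ : 0 < μ) (hL : 0 < L) (hlam : 0 < lam) (hp : a.p = lam / (lam + L))
    (ha : Admissible (μ / n) ((lam + L) / n) a)
    (hs : ∀ i j, Smooth L (ft i j)) (hc : ∀ i j, StronglyConvex μ (ft i j))
    {xs : Joint n d} (hxs : ∀ y, objective ft lam xs ≤ objective ft lam y)
    (k : ℕ) (s : State n d) :
    ∫ ω, potential ft lam a xs (step ft lam a (agg k ω) (refresh k ω) (idx k ω) s) ∂P
      ≤ (1 - a.ρ * a.θ₁ / 2) * potential ft lam a xs s := by
  have hp0 : 0 < a.p := by rw [hp]; positivity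
  have hp1 : a.p < 1 := by rw [hp, div_lt_one (by positivity)]; linarith
  have hft : ∀ i j, Differentiable ℝ (ft i j) := fun i j => (hs i j).1
  rw [hS.integral_draw k fun b r J => potential ft lam a xs (step ft lam a b r J s)]
  have ht := mul_le_mul_of_nonneg_left
    (expect_refresh_potential_le hS hn hm hlam ha hs k s xs true) hp0.le
  have hf := mul_le_mul_of_nonneg_left
    (expect_refresh_potential_le hS hn hm hlam ha hs k s xs false) (sub_nonneg.2 hp1.le)
  refine (add_le_add ht hf).trans ?_
  have e1 := expect_inner_gradEst (lam := lam) hS hp0 hp1 hft k (s.x a) s.w (drift a s xs)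
  have e2 := expect_inner_gradEst (lam := lam) hS hp0 hp1 hft k (s.x a) s.w
    (objGrad ft lam (s.x a))
  rw [real_inner_self_eq_norm_sq] at e2
  have h := drift_estimate hn hm hμ hlam ha hc s hxs
    (expect_sq_norm_gradEst_le hS hn hμ hL hlam hp hs hc k (s.x a) s.w)
  rw [← e1, ← e2] at h
  refine le_trans (le_of_eq ?_) ((add_le_add_left h _).trans (combine_coefficients ha
    (sq_nonneg ‖s.z - xs‖) (sub_nonneg.2 (hxs s.y)) (sub_nonneg.2 (hxs s.w))
    (2 * a.γ * a.β / a.θ₁ * objective ft lam xs)))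
  ring

theorem iter_congr {lam : ℝ} {a : Params} {x0 : Joint n d} {A A' R R' : ℕ → Bool}
    {J J' : ℕ → Fin n → Fin m} {k : ℕ}
    (h : ∀ t < k, A t = A' t ∧ R t = R' t ∧ J t = J' t) :
    iter ft lam a x0 A R J k = iter ft lam a x0 A' R' J' k := by
  induction k with
  | zero => rfl
  | succ k ih =>
    obtain ⟨h1, h2, h3⟩ := h k (Nat.lt_succ_self k)
    rw [iter, iter, ih fun t ht => h t (ht.trans (Nat.lt_succ_self k)), h1, h2, h3]

/-- The iterates along a given history of the first `k` draws. -/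
def iterOfHistory (ft : Fin n → Fin m → Model d → ℝ) (lam : ℝ) (a : Params) (x0 : Joint n d)
    (j₀ : Fin m) (k : ℕ) (h : Finset.range k → Bool × Bool × (Fin n → Fin m)) : State n d :=
  iter ft lam a x0 (fun t => if ht : t ∈ Finset.range k then (h ⟨t, ht⟩).1 else false)
    (fun t => if ht : t ∈ Finset.range k then (h ⟨t, ht⟩).2.1 else false)
    (fun t => if ht : t ∈ Finset.range k then (h ⟨t, ht⟩).2.2 else fun _ => j₀) k

theorem iter_eq_iterOfHistory (ft : Fin n → Fin m → Model d → ℝ) (lam : ℝ) (a : Params)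
    (x0 : Joint n d) (j₀ : Fin m) (k : ℕ) (A R : ℕ → Bool) (J : ℕ → Fin n → Fin m) :
    iter ft lam a x0 A R J k
      = iterOfHistory ft lam a x0 j₀ k fun t => (A t, R t, J t) :=
  iter_congr fun t ht => by simp [ht]

/-- No measurability of `φ` is needed: the state is a function of a history with finitely many
values. -/
theorem integrable_comp_iter (hS : IsSampling P a.p a.ρ agg refresh idx) (hm : 1 ≤ m)
    (x0 : Joint n d) (k : ℕ) (φ : State n d → ℝ) :
    Integrable (fun ω => φ (iter ft lam a x0 (fun t => agg t ω) (fun t => refresh t ω)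
      (fun t => idx t ω) k)) P := by
  simp only [iter_eq_iterOfHistory ft lam a x0 ⟨0, hm⟩]
  exact integrable_comp_of_finite
    (X := fun ω (t : Finset.range k) => (agg t ω, refresh t ω, idx t ω))
    (measurable_pi_lambda _ fun t => hS.measurable_draw t)
    (fun h => φ (iterOfHistory ft lam a x0 ⟨0, hm⟩ k h))

theorem expect_potential_iter_le (hS : IsSampling P a.p a.ρ agg refresh idx) (hn : 1 ≤ n)
    (hm : 1 ≤ m) (hμ : 0 < μ) (hL : 0 < L) (hlam : 0 < lam) (hp : a.p = lam / (lam + L))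
    (ha : Admissible (μ / n) ((lam + L) / n) a)
    (hs : ∀ i j, Smooth L (ft i j)) (hc : ∀ i j, StronglyConvex μ (ft i j))
    {xs : Joint n d} (hxs : ∀ y, objective ft lam xs ≤ objective ft lam y)
    (x0 : Joint n d) (k : ℕ) :
    ∫ ω, potential ft lam a xs (iter ft lam a x0 (fun t => agg t ω) (fun t => refresh t ω)
        (fun t => idx t ω) k) ∂P
      ≤ (1 - a.ρ * a.θ₁ / 2) ^ k * potential ft lam a xs ⟨x0, x0, x0⟩ := by
  have hrate : 0 ≤ 1 - a.ρ * a.θ₁ / 2 := by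
    nlinarith [ha.rho_pos, ha.rho_le, ha.theta_one_pos, ha.theta_one_le]
  induction k with
  | zero => simp [iter]
  | succ k ih =>
    have hmeas : Measurable fun ω (t : Finset.range k) => (agg t ω, refresh t ω, idx t ω) :=
      measurable_pi_lambda _ fun t => hS.measurable_draw t
    -- The current draw is independent of the whole history, so the one-step contraction may be
    -- applied with the state frozen.
    have hind : IndepFun (fun ω (t : Finset.range k) => (agg t ω, refresh t ω, idx t ω))
        (fun ω => (agg k ω, refresh k ω, idx k ω)) P :=
      (hS.indep_iterations.indepFun_finset (Finset.range k) {k} (by simp)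
        hS.measurable_draw).comp measurable_id
        (measurable_pi_apply (⟨k, Finset.mem_singleton_self k⟩ : ({k} : Finset ℕ)))
    have h := integral_comp_of_indepFun hmeas (hS.measurable_draw k) hind fun h q =>
      potential ft lam a xs
        (step ft lam a q.1 q.2.1 q.2.2 (iterOfHistory ft lam a x0 ⟨0, hm⟩ k h))
    have e : ∀ ω, iter ft lam a x0 (fun t => agg t ω) (fun t => refresh t ω) (fun t => idx t ω) k
        = iterOfHistory ft lam a x0 ⟨0, hm⟩ k fun t => (agg t ω, refresh t ω, idx t ω) :=
      fun ω => iter_eq_iterOfHistory ft lam a x0 ⟨0, hm⟩ k _ _ _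
    simp only [← e] at h
    simp only [iter]
    rw [h, pow_succ', mul_assoc]
    refine le_trans ?_ (mul_le_mul_of_nonneg_left ih hrate)
    rw [← integral_const_mul]
    refine integral_mono ?_ ?_ fun ω =>
      expect_step_potential_le hS hn hm hμ hL hlam hp ha hs hc hxs k _
    · exact integrable_comp_iter (ft := ft) (lam := lam) hS hm x0 k fun s => ∫ ω',
        potential ft lam a xs (step ft lam a (agg k ω') (refresh k ω') (idx k ω') s) ∂P
    · exact (integrable_comp_iter hS hm x0 k _).const_mul _

/-- The accuracy `ε` is reached after `log (4 / ε) / (ρ θ₁ / 2)` iterations. -/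
theorem expect_lyapunovAt_le (hS : IsSampling P a.p a.ρ agg refresh idx) (hn : 1 ≤ n)
    (hm : 1 ≤ m) (hμ : 0 < μ) (hL : 0 < L) (hlam : 0 < lam) (hp : a.p = lam / (lam + L))
    (ha : Admissible (μ / n) ((lam + L) / n) a)
    (hs : ∀ i j, Smooth L (ft i j)) (hc : ∀ i j, StronglyConvex μ (ft i j))
    {xs : Joint n d} (hxs : ∀ y, objective ft lam xs ≤ objective ft lam y)
    (x0 : Joint n d) {ε : ℝ} (hε : 0 < ε) {k : ℕ}
    (hk : Real.log (4 / ε) / (a.ρ * a.θ₁ / 2) ≤ k) :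
    Integrable (lyapunovAt ft lam a x0 xs agg refresh idx k) P ∧
      ∫ ω, lyapunovAt ft lam a x0 xs agg refresh idx k ω ∂P
        ≤ ε * lyapunov ft lam a xs ⟨x0, x0, x0⟩ := by
  have hint := integrable_comp_iter (ft := ft) (lam := lam) hS hm x0 k (lyapunov ft lam a xs)
  refine ⟨hint, ?_⟩
  have hint' := integrable_comp_iter (ft := ft) (lam := lam) hS hm x0 k (potential ft lam a xs)
  have h1 := potential_le_lyapunov ha hxs ⟨x0, x0, x0⟩
  have h2 := lyapunov_le_potential ha hxs ⟨x0, x0, x0⟩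
  have hc0 : 0 < a.ρ * a.θ₁ / 2 := by
    have := ha.rho_pos
    have := ha.theta_one_pos
    positivity
  -- The target is `ε / 4` because of the factor `4` between the two Lyapunov functions.
  have hpow : (1 - a.ρ * a.θ₁ / 2) ^ k ≤ ε / 4 := by
    rw [div_le_iff₀ hc0] at hk
    calc (1 - a.ρ * a.θ₁ / 2) ^ k ≤ Real.exp (-(a.ρ * a.θ₁ / 2)) ^ k := by
          gcongr
          · nlinarith [ha.rho_pos, ha.rho_le, ha.theta_one_pos, ha.theta_one_le]
          · exact Real.one_sub_le_exp_neg _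
      _ = Real.exp (-(k * (a.ρ * a.θ₁ / 2))) := by rw [← Real.exp_nat_mul]; congr 1; ring
      _ ≤ Real.exp (-Real.log (4 / ε)) := by gcongr
      _ = ε / 4 := by rw [← Real.log_inv, Real.exp_log (by positivity), inv_div]
  calc ∫ ω, lyapunovAt ft lam a x0 xs agg refresh idx k ω ∂P
      ≤ ∫ ω, 4 * potential ft lam a xs (iter ft lam a x0 (fun t => agg t ω)
          (fun t => refresh t ω) (fun t => idx t ω) k) ∂P :=
        integral_mono hint (hint'.const_mul 4) fun ω => lyapunov_le_potential ha hxs _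
    _ ≤ 4 * ((1 - a.ρ * a.θ₁ / 2) ^ k * potential ft lam a xs ⟨x0, x0, x0⟩) := by
        rw [integral_const_mul]
        gcongr
        exact expect_potential_iter_le hS hn hm hμ hL hlam hp ha hs hc hxs x0 k
    _ ≤ 4 * (ε / 4 * potential ft lam a xs ⟨x0, x0, x0⟩) := by
        gcongr
        linarith
    _ ≤ ε * lyapunov ft lam a xs ⟨x0, x0, x0⟩ := by
        have := mul_le_mul_of_nonneg_left h1 hε.le
        linarith

end Contraction

/-! ### The parameter choice -/

section Parameters

variable {n : ℕ} {μ L lam ρ : ℝ}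

theorem expSmooth_eq (hn : 1 ≤ n) (hL : 0 < L) (hlam : 0 < lam) :
    expSmooth n L lam (lam / (lam + L)) = (lam + L) / n := by
  have h1 : 1 - lam / (lam + L) = L / (lam + L) := by field_simp; ring
  have h2 : L / (n * (L / (lam + L))) = (lam + L) / n := by field_simp
  have h3 : lam / (n * (lam / (lam + L))) = (lam + L) / n := by field_simp
  rw [expSmooth, h1, h2, h3, max_self]

theorem etaOf_eq (hn : 1 ≤ n) (hL : 0 < L) (hlam : 0 < lam) :
    etaOf n L lam (lam / (lam + L)) = 1 / (4 * ((lam + L) / n)) := by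
  have h : objSmooth n L lam = (lam + L) / n := by rw [objSmooth]; ring
  rw [etaOf, expSmooth_eq hn hL hlam, h, max_self]
  field_simp

theorem thetaTwoOf_eq (hn : 1 ≤ n) (hL : 0 < L) (hlam : 0 < lam) :
    thetaTwoOf n L lam (lam / (lam + L)) = 1 / 2 := by
  have h : objSmooth n L lam = (lam + L) / n := by rw [objSmooth]; ring
  rw [thetaTwoOf, expSmooth_eq hn hL hlam, h, max_self]
  field_simp

/-- Since `ρ ≤ 1`, the inner maximum is `θ₂ / ρ = 1 / (2 ρ)`. -/
theorem thetaOneOf_eq (hn : 1 ≤ n) (hL : 0 < L) (hlam : 0 < lam) (hρ : 0 < ρ) (hρ1 : ρ ≤ 1) :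
    thetaOneOf n μ L lam (lam / (lam + L)) ρ
      = min (1 / 2) (Real.sqrt (μ / (8 * ρ * (lam + L)))) := by
  have h : max (1 / 2) (1 / 2 / ρ) = 1 / 2 / ρ := by
    refine max_eq_right ?_
    rw [le_div_iff₀ hρ]
    linarith
  rw [thetaOneOf, etaOf_eq hn hL hlam, thetaTwoOf_eq hn hL hlam, h]
  congr 2
  field_simp
  ring

theorem thetaOneOf_pos (hn : 1 ≤ n) (hμ : 0 < μ) (hL : 0 < L) (hlam : 0 < lam) (hρ : 0 < ρ)
    (hρ1 : ρ ≤ 1) : 0 < thetaOneOf n μ L lam (lam / (lam + L)) ρ := by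
  rw [thetaOneOf_eq hn hL hlam hρ hρ1]
  exact lt_min (by norm_num) (Real.sqrt_pos.2 (by positivity))

theorem inv_thetaOneOf_le (hn : 1 ≤ n) (hμ : 0 < μ) (hL : 0 < L) (hlam : 0 < lam) (hρ : 0 < ρ)
    (hρ1 : ρ ≤ 1) :
    (thetaOneOf n μ L lam (lam / (lam + L)) ρ)⁻¹ ≤ 2 + 3 * Real.sqrt (ρ * (lam + L) / μ) := by
  have h0 := Real.sqrt_nonneg (ρ * (lam + L) / μ)
  rw [thetaOneOf_eq hn hL hlam hρ hρ1]
  rcases min_choice (1 / 2) (Real.sqrt (μ / (8 * ρ * (lam + L)))) with h | h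
  · rw [h]
    norm_num
  · rw [h, ← Real.sqrt_inv, inv_div]
    have : Real.sqrt (8 * ρ * (lam + L) / μ) ≤ 3 * Real.sqrt (ρ * (lam + L) / μ) := by
      rw [Real.sqrt_le_left (by positivity), mul_pow, Real.sq_sqrt (by positivity)]
      have : 0 ≤ ρ * (lam + L) / μ := by positivity
      calc 8 * ρ * (lam + L) / μ = 8 * (ρ * (lam + L) / μ) := by ring
        _ ≤ 3 ^ 2 * (ρ * (lam + L) / μ) := by linarith
    linarith

theorem admissible_params (hn : 1 ≤ n) (hμ : 0 < μ) (hL : 0 < L) (hlam : 0 < lam) (hρ : 0 < ρ)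
    (hρ1 : ρ ≤ 1) :
    Admissible (μ / n) ((lam + L) / n) (params n μ L lam (lam / (lam + L)) ρ) := by
  have hn' : (0 : ℝ) < n := by positivity
  have hη : 0 < etaOf n L lam (lam / (lam + L)) := by
    rw [etaOf_eq hn hL hlam]
    positivity
  have hθ := thetaOneOf_pos hn hμ hL hlam hρ hρ1
  set η := etaOf n L lam (lam / (lam + L)) with hη'
  set θ := thetaOneOf n μ L lam (lam / (lam + L)) ρ with hθ'
  have hγ : gammaOf n μ L lam (lam / (lam + L)) ρ = 1 / max (2 * μ / n) (4 * θ / η) := rfl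
  have hmax : 0 < max (2 * μ / n) (4 * θ / η) := lt_max_of_lt_left (by positivity)
  have hγσ : gammaOf n μ L lam (lam / (lam + L)) ρ * (μ / n) ≤ 1 / 2 := by
    rw [hγ, one_div_mul_eq_div, div_le_iff₀ hmax]
    have := le_max_left (2 * μ / n) (4 * θ / η)
    have e : 2 * μ / n = 2 * (μ / n) := mul_div_assoc _ _ _
    linarith
  have hθsq : θ ^ 2 ≤ μ / (8 * ρ * (lam + L)) := by
    rw [hθ', thetaOneOf_eq hn hL hlam hρ hρ1] at hθ ⊢
    calc (min (1 / 2) (Real.sqrt (μ / (8 * ρ * (lam + L))))) ^ 2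
        ≤ Real.sqrt (μ / (8 * ρ * (lam + L))) ^ 2 := by gcongr; exact min_le_right _ _
      _ = _ := Real.sq_sqrt (by positivity)
  refine ⟨hρ, hρ1, by positivity, etaOf_eq hn hL hlam, thetaTwoOf_eq hn hL hlam, hθ,
    min_le_left _ _, ?_, ?_, ?_, ?_, ?_⟩
  · change 0 < 1 / max (2 * μ / n) (4 * θ / η)
    positivity
  · change 1 / max (2 * μ / n) (4 * θ / η) * θ ≤ η / 4
    rw [one_div_mul_eq_div, div_le_iff₀ hmax]
    calc θ = η / 4 * (4 * θ / η) := by field_simp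
      _ ≤ _ := by gcongr; exact le_max_right _ _
  · change 1 - _ * μ / n = 1 - _ * (μ / n)
    rw [mul_div_assoc]
    rfl
  · change 1 / 2 ≤ 1 - _ * μ / n
    rw [mul_div_assoc]
    linarith
  · change ρ * θ / 2 ≤ 1 / max (2 * μ / n) (4 * θ / η) * (μ / n)
    rw [one_div_mul_eq_div, le_div_iff₀ hmax, mul_max_of_nonneg _ _ (by positivity)]
    refine max_le ?_ ?_
    · have h1 : ρ * θ ≤ 1 := by
        have : θ ≤ 1 / 2 := min_le_left _ _
        nlinarith
      calc ρ * θ / 2 * (2 * μ / n) = ρ * θ * (μ / n) := by ring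
        _ ≤ 1 * (μ / n) := by gcongr
        _ = μ / n := one_mul _
    -- Here the size of `θ₁` is decisive: the bound is tight when the square root attains the
    -- minimum.
    · calc ρ * θ / 2 * (4 * θ / η) = 2 * ρ / η * θ ^ 2 := by ring
        _ ≤ 2 * ρ / η * (μ / (8 * ρ * (lam + L))) := by gcongr
        _ = μ / n := by
          rw [hη', etaOf_eq hn hL hlam]
          field_simp
          norm_num

end Parameters

/-! ### Expected costs -/

section Costs

variable {Ω : Type*} [MeasurableSpace Ω] {P : Measure Ω} [IsProbabilityMeasure P] {n m : ℕ}
  {p ρ : ℝ} {agg refresh : ℕ → Ω → Bool} {idx : ℕ → Ω → Fin n → Fin m}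

theorem integral_commRounds (hS : IsSampling P p ρ agg refresh idx) (K : ℕ) :
    Integrable (fun ω => (commRounds (fun t => agg t ω) (fun t => refresh t ω) K : ℝ)) P ∧
      ∫ ω, (commRounds (fun t => agg t ω) (fun t => refresh t ω) K : ℝ) ∂P
        = 1 + K * ρ + (K - 1 : ℕ) * (2 * p * (1 - p)) := by
  have hr : ∀ k, Integrable (fun ω => if refresh k ω then (1 : ℝ) else 0) P := fun k =>
    integrable_comp_of_finite (hS.measurable_refresh k) fun b => if b then (1 : ℝ) else 0
  have ha : ∀ k, Integrable (fun ω => if agg (k + 1) ω ≠ agg k ω then (1 : ℝ) else 0) P := fun k =>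
    integrable_comp_of_finite ((hS.measurable_agg (k + 1)).prodMk (hS.measurable_agg k))
      fun q => if q.1 ≠ q.2 then (1 : ℝ) else 0
  have er : ∀ k, ∫ ω, (if refresh k ω then (1 : ℝ) else 0) ∂P = ρ := fun k => by
    rw [integral_comp_bool (hS.measurable_refresh k) (hS.prob_refresh k)
      fun b => if b then (1 : ℝ) else 0]
    simp
  -- Consecutive coins are independent, hence differ with probability `2 p (1 - p)`.
  have ea : ∀ k, ∫ ω, (if agg (k + 1) ω ≠ agg k ω then (1 : ℝ) else 0) ∂P = 2 * p * (1 - p) :=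
    fun k => by
    have hind : IndepFun (agg (k + 1)) (agg k) P :=
      (hS.indep_iterations.indepFun (Nat.succ_ne_self k)).comp measurable_fst measurable_fst
    rw [integral_comp_of_indepFun (hS.measurable_agg (k + 1)) (hS.measurable_agg k) hind
        fun b c => if b ≠ c then (1 : ℝ) else 0,
      integral_comp_bool (hS.measurable_agg (k + 1)) (hS.prob_agg (k + 1))
        fun b => ∫ ω', (if b ≠ agg k ω' then (1 : ℝ) else 0) ∂P,
      integral_comp_bool (hS.measurable_agg k) (hS.prob_agg k)
        fun c => if true ≠ c then (1 : ℝ) else 0,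
      integral_comp_bool (hS.measurable_agg k) (hS.prob_agg k)
        fun c => if false ≠ c then (1 : ℝ) else 0]
    simp
    ring
  have hsr := integrable_finsetSum (Finset.range K) fun k _ => hr k
  have hsa := integrable_finsetSum (Finset.range (K - 1)) fun k _ => ha k
  have h1 : Integrable (fun ω => 1 + ∑ k ∈ Finset.range K, if refresh k ω then (1 : ℝ) else 0) P :=
    (integrable_const 1).add hsr
  simp only [commRounds, Nat.cast_add, Nat.cast_one, Nat.cast_sum, Nat.cast_ite, Nat.cast_zero]
  refine ⟨h1.add hsa, ?_⟩
  rw [integral_add h1 hsa, integral_add (integrable_const 1) hsr,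
    integral_finsetSum _ fun k _ => hr k, integral_finsetSum _ fun k _ => ha k]
  simp only [er, ea, integral_const, probReal_univ, Finset.sum_const, Finset.card_range,
    nsmul_eq_mul, one_smul]

theorem integral_summandGrads (hS : IsSampling P p ρ agg refresh idx) (K : ℕ) :
    Integrable (fun ω => (summandGrads m (fun t => agg t ω) (fun t => refresh t ω) K : ℝ)) P ∧
      ∫ ω, (summandGrads m (fun t => agg t ω) (fun t => refresh t ω) K : ℝ) ∂P
        = m + K * ((1 - p) * 2 + ρ * m) := by
  have hr : ∀ k, Integrable (fun ω => if refresh k ω then (m : ℝ) else 0) P := fun k =>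
    integrable_comp_of_finite (hS.measurable_refresh k) fun b => if b then (m : ℝ) else 0
  have ha : ∀ k, Integrable (fun ω => if agg k ω then (0 : ℝ) else 2) P := fun k =>
    integrable_comp_of_finite (hS.measurable_agg k) fun b => if b then (0 : ℝ) else 2
  have er : ∀ k, ∫ ω, (if refresh k ω then (m : ℝ) else 0) ∂P = ρ * m := fun k => by
    rw [integral_comp_bool (hS.measurable_refresh k) (hS.prob_refresh k)
      fun b => if b then (m : ℝ) else 0]
    simp
  have ea : ∀ k, ∫ ω, (if agg k ω then (0 : ℝ) else 2) ∂P = (1 - p) * 2 := fun k => by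
    rw [integral_comp_bool (hS.measurable_agg k) (hS.prob_agg k)
      fun b => if b then (0 : ℝ) else 2]
    simp
  have hadd : ∀ k, Integrable
      (fun ω => (if agg k ω then (0 : ℝ) else 2) + if refresh k ω then (m : ℝ) else 0) P :=
    fun k => (ha k).add (hr k)
  have hs := integrable_finsetSum (Finset.range K) fun k _ => hadd k
  simp only [summandGrads, Nat.cast_add, Nat.cast_sum, Nat.cast_ite, Nat.cast_zero, Nat.cast_ofNat]
  refine ⟨(integrable_const _).add hs, ?_⟩
  rw [integral_add (integrable_const _) hs, integral_finsetSum _ fun k _ => hadd k]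
  simp only [integral_add (ha _) (hr _), er, ea, integral_const, probReal_univ,
    Finset.sum_const, Finset.card_range, nsmul_eq_mul, one_smul]

end Costs

/-! ### The number of iterations -/

/-- An iteration number that suffices for the accuracy `ε`. -/
def iterCount (n : ℕ) (μ L lam ρ ε : ℝ) : ℕ :=
  ⌈Real.log (4 / ε) / (ρ * thetaOneOf n μ L lam (lam / (lam + L)) ρ / 2)⌉₊

theorem half_le_log {ε : ℝ} (hε : 0 < ε) (hε2 : ε ≤ 1 / 2) : 1 / 2 ≤ Real.log (1 / ε) := by
  have h : Real.log 2 ≤ Real.log (1 / ε) := by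
    refine Real.log_le_log two_pos ?_
    rw [le_div_iff₀ hε]
    linarith
  linarith [Real.log_two_gt_d9]

theorem log_four_div_le {ε : ℝ} (hε : 0 < ε) (hε2 : ε ≤ 1 / 2) :
    Real.log (4 / ε) ≤ 3 * Real.log (1 / ε) := by
  have h : Real.log 2 ≤ Real.log (1 / ε) := by
    refine Real.log_le_log two_pos ?_
    rw [le_div_iff₀ hε]
    linarith
  have h4 : Real.log 4 = 2 * Real.log 2 := by
    rw [show (4 : ℝ) = 2 ^ 2 by norm_num, Real.log_pow]
    norm_num
  have : Real.log (4 / ε) = Real.log 4 + Real.log (1 / ε) := by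
    rw [← Real.log_mul (by norm_num) (by positivity), mul_one_div]
  linarith

theorem rho_mul_iterCount_le {n : ℕ} {μ L lam ρ ε : ℝ} (hn : 1 ≤ n) (hμ : 0 < μ) (hL : 0 < L)
    (hlam : 0 < lam) (hρ : 0 < ρ) (hρ1 : ρ ≤ 1) (hε : 0 < ε) (hε2 : ε ≤ 1 / 2) :
    ρ * iterCount n μ L lam ρ ε
      ≤ 6 * Real.log (1 / ε) * (2 + 3 * Real.sqrt (ρ * (lam + L) / μ)) + ρ := by
  have hθ := thetaOneOf_pos hn hμ hL hlam hρ hρ1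
  have hinv := inv_thetaOneOf_le hn hμ hL hlam hρ hρ1
  have hlog := log_four_div_le hε hε2
  have hhalf := half_le_log hε hε2
  have h0 : 0 ≤ Real.log (4 / ε) := Real.log_nonneg (by rw [le_div_iff₀ hε]; linarith)
  rw [iterCount]
  set θ := thetaOneOf n μ L lam (lam / (lam + L)) ρ
  have hceil := (Nat.ceil_lt_add_one (div_nonneg h0 (by positivity : 0 ≤ ρ * θ / 2))).le
  calc ρ * (⌈Real.log (4 / ε) / (ρ * θ / 2)⌉₊ : ℝ)
      ≤ ρ * (Real.log (4 / ε) / (ρ * θ / 2) + 1) := by gcongr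
    _ = 2 * Real.log (4 / ε) * θ⁻¹ + ρ := by field_simp
    _ ≤ 2 * (3 * Real.log (1 / ε)) * (2 + 3 * Real.sqrt (ρ * (lam + L) / μ)) + ρ := by gcongr
    _ = _ := by ring

theorem comm_cost_le {n : ℕ} {μ L lam p ρ ε : ℝ} (hn : 1 ≤ n) (hμ : 0 < μ) (hL : 0 < L)
    (hlam : 0 < lam) (hμL : μ ≤ L) (hμlam : μ ≤ lam) (hp : p = lam / (lam + L))
    (hρ : ρ = p * (1 - p)) (hε : 0 < ε) (hε2 : ε ≤ 1 / 2) :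
    1 + (iterCount n μ L lam ρ ε : ℝ) * ρ
        + (iterCount n μ L lam ρ ε - 1 : ℕ) * (2 * p * (1 - p))
      ≤ 100 * (Real.sqrt (min L lam / μ) * Real.log (1 / ε)) := by
  have hp1 : 1 - p = L / (lam + L) := by rw [hp]; field_simp; ring
  have hρ0 : 0 < ρ := by rw [hρ, hp1, hp]; positivity
  have hρ1 : ρ ≤ 1 := by rw [hρ]; nlinarith [sq_nonneg (p - 1 / 2)]
  have hK := rho_mul_iterCount_le hn hμ hL hlam hρ0 hρ1 hε hε2
  have hhalf := half_le_log hε hε2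
  have hsub : ((iterCount n μ L lam ρ ε - 1 : ℕ) : ℝ) ≤ iterCount n μ L lam ρ ε := by
    exact_mod_cast Nat.sub_le _ _
  have hR1 : 1 ≤ Real.sqrt (min L lam / μ) := by
    rw [Real.one_le_sqrt, le_div_iff₀ hμ, one_mul]
    exact le_min hμL hμlam
  have hR : Real.sqrt (ρ * (lam + L) / μ) ≤ Real.sqrt (min L lam / μ) := by
    refine Real.sqrt_le_sqrt (div_le_div_of_nonneg_right ?_ hμ.le)
    have e : ρ * (lam + L) = lam * L / (lam + L) := by rw [hρ, hp1, hp]; field_simp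
    rw [e, div_le_iff₀ (by positivity)]
    rcases min_choice L lam with h | h <;> rw [h] <;> nlinarith [mul_pos hL hL, mul_pos hlam hlam]
  have h2 : ((iterCount n μ L lam ρ ε - 1 : ℕ) : ℝ) * (2 * p * (1 - p))
      ≤ 2 * (ρ * iterCount n μ L lam ρ ε) := by
    have e : 2 * p * (1 - p) = 2 * ρ := by rw [hρ]; ring
    rw [e]
    nlinarith
  set R := Real.sqrt (min L lam / μ)
  set l := Real.log (1 / ε)
  have h3 : 6 * l * (2 + 3 * Real.sqrt (ρ * (lam + L) / μ)) ≤ 6 * l * (2 * R + 3 * R) := by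
    gcongr
    linarith
  -- The cost is at most `1 + 3 ρ K ≤ 90 l R + 1 + 3 ρ`; as `l R ≥ 1 / 2`, the additive part is at
  -- most `8 l R`.
  have h4 : 1 / 2 * 1 ≤ l * R := mul_le_mul hhalf hR1 zero_le_one (by linarith)
  linarith

theorem grad_cost_le {n m : ℕ} {μ L lam p ρ ε : ℝ} (hn : 1 ≤ n) (hm : 1 ≤ m) (hμ : 0 < μ)
    (hL : 0 < L) (hlam : 0 < lam) (hp : p = lam / (lam + L)) (hρ : ρ = 1 / (m : ℝ))
    (hε : 0 < ε) (hε2 : ε ≤ 1 / 2) :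
    (m : ℝ) + (iterCount n μ L lam ρ ε : ℝ) * ((1 - p) * 2 + ρ * m)
      ≤ 100 * (((m : ℝ) + Real.sqrt ((m : ℝ) * (L + lam) / μ)) * Real.log (1 / ε)) := by
  have hm1 : (1 : ℝ) ≤ m := by exact_mod_cast hm
  have hm0 : (0 : ℝ) < m := by linarith
  have hp0 : 0 < p := by rw [hp]; positivity
  have hρ0 : 0 < ρ := by rw [hρ]; positivity
  have hρ1 : ρ ≤ 1 := by rw [hρ, div_le_one hm0]; exact hm1
  have hρm : ρ * m = 1 := by rw [hρ]; field_simp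
  have hK := rho_mul_iterCount_le hn hμ hL hlam hρ0 hρ1 hε hε2
  have hhalf := half_le_log hε hε2
  have hR : m * Real.sqrt (ρ * (lam + L) / μ) = Real.sqrt (m * (L + lam) / μ) := by
    rw [← Real.sqrt_sq hm0.le, ← Real.sqrt_mul (by positivity), Real.sqrt_sq hm0.le, hρ]
    congr 1
    field_simp
    ring
  have hR0 := Real.sqrt_nonneg (m * (L + lam) / μ)
  have hKm := mul_le_mul_of_nonneg_left hK hm0.le
  set R := Real.sqrt (m * (L + lam) / μ)
  set l := Real.log (1 / ε)
  set K : ℝ := (iterCount n μ L lam ρ ε : ℝ)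
  have hK0 : 0 ≤ K := Nat.cast_nonneg _
  -- Multiplying the bound on `ρ K` by `m` recovers `K`, since `ρ m = 1`.
  have e1 : m * (ρ * K) = K := by linear_combination K * hρm
  have e2 : m * (6 * l * (2 + 3 * Real.sqrt (ρ * (lam + L) / μ)) + ρ)
      = 12 * (m * l) + 18 * (R * l) + 1 := by
    rw [← hR]
    linear_combination hρm
  rw [e1, e2] at hKm
  have h1 : K * ((1 - p) * 2 + ρ * m) ≤ K * 3 := by
    gcongr
    linarith
  have h2 : (m : ℝ) * (1 / 2) ≤ m * l := by gcongr
  have h3 : 0 ≤ R * l := mul_nonneg hR0 (by linarith)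
  linarith

end AL2SGD

end

/-! ### The two complexity bounds -/

theorem mainTheorem8 :
    ∃ C : ℝ, 0 < C ∧
      ∀ (n m d : ℕ), 1 ≤ n → 1 ≤ m → 1 ≤ d →
      ∀ (μ L lam ε : ℝ), 0 < μ → 0 < L → 0 < lam → 0 < ε → ε ≤ 1 / 2 →
      ∃ Kcomm Kgrad : ℕ,
        ∀ (ft : Fin n → Fin m → AL2SGD.Model d → ℝ),
          (∀ i j, AL2SGD.Smooth L (ft i j)) →
          (∀ i j, AL2SGD.StronglyConvex μ (ft i j)) →
        ∀ (x0 xs : AL2SGD.Joint n d), IsMinOn (AL2SGD.objective ft lam) Set.univ xs →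
        ∀ (Ω : Type*) [MeasurableSpace Ω] (P : MeasureTheory.Measure Ω)
          [MeasureTheory.IsProbabilityMeasure P]
          (agg refresh : ℕ → Ω → Bool) (idx : ℕ → Ω → Fin n → Fin m) (p ρ : ℝ),
          p = lam / (lam + L) →
          AL2SGD.IsSampling P p ρ agg refresh idx →
          -- communication complexity
          (μ ≤ lam → ρ = p * (1 - p) →
            (∀ k, Kcomm ≤ k →
              MeasureTheory.Integrable
                (AL2SGD.lyapunovAt ft lam (AL2SGD.params n μ L lam p ρ) x0 xs agg refresh idx k) P ∧
              ∫ ω, AL2SGD.lyapunovAt ft lam (AL2SGD.params n μ L lam p ρ) x0 xs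
                  agg refresh idx k ω ∂P
                ≤ ε * AL2SGD.lyapunov ft lam (AL2SGD.params n μ L lam p ρ) xs ⟨x0, x0, x0⟩) ∧
            MeasureTheory.Integrable
              (fun ω => (AL2SGD.commRounds (fun t => agg t ω) (fun t => refresh t ω) Kcomm : ℝ)) P ∧
            ∫ ω, (AL2SGD.commRounds (fun t => agg t ω) (fun t => refresh t ω) Kcomm : ℝ) ∂P
              ≤ C * (Real.sqrt (min L lam / μ) * Real.log (1 / ε))) ∧
          -- local summand gradient complexity
          (ρ = 1 / (m : ℝ) →
            (∀ k, Kgrad ≤ k →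
              MeasureTheory.Integrable
                (AL2SGD.lyapunovAt ft lam (AL2SGD.params n μ L lam p ρ) x0 xs agg refresh idx k) P ∧
              ∫ ω, AL2SGD.lyapunovAt ft lam (AL2SGD.params n μ L lam p ρ) x0 xs
                  agg refresh idx k ω ∂P
                ≤ ε * AL2SGD.lyapunov ft lam (AL2SGD.params n μ L lam p ρ) xs ⟨x0, x0, x0⟩) ∧
            MeasureTheory.Integrable
              (fun ω => (AL2SGD.summandGrads m (fun t => agg t ω) (fun t => refresh t ω) Kgrad : ℝ))
              P ∧
            ∫ ω, (AL2SGD.summandGrads m (fun t => agg t ω) (fun t => refresh t ω) Kgrad : ℝ) ∂P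
              ≤ C * (((m : ℝ) + Real.sqrt ((m : ℝ) * (L + lam) / μ)) * Real.log (1 / ε))) := by
  -- The iteration numbers are chosen before `p` and `ρ` are introduced, so both probabilities are
  -- written out in terms of `lam`, `L` and `m`.
  refine ⟨100, by norm_num, fun n m d hn hm hd μ L lam ε hμ hL hlam hε hε2 =>
    ⟨AL2SGD.iterCount n μ L lam (lam / (lam + L) * (1 - lam / (lam + L))) ε,
      AL2SGD.iterCount n μ L lam (1 / (m : ℝ)) ε, ?_⟩⟩
  intro ft hs hc x0 xs hxs Ω _ P _ agg refresh idx p ρ hp hS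
  have hmin : ∀ y, AL2SGD.objective ft lam xs ≤ AL2SGD.objective ft lam y := fun y =>
    hxs (Set.mem_univ y)
  have hμL : μ ≤ L := (hc ⟨0, hn⟩ ⟨0, hm⟩).le_of_smooth hd (hs _ _)
  have hconv : 0 < ρ → ρ ≤ 1 → ∀ k, AL2SGD.iterCount n μ L lam ρ ε ≤ k →
      MeasureTheory.Integrable
        (AL2SGD.lyapunovAt ft lam (AL2SGD.params n μ L lam p ρ) x0 xs agg refresh idx k) P ∧
      ∫ ω, AL2SGD.lyapunovAt ft lam (AL2SGD.params n μ L lam p ρ) x0 xs agg refresh idx k ω ∂P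
        ≤ ε * AL2SGD.lyapunov ft lam (AL2SGD.params n μ L lam p ρ) xs ⟨x0, x0, x0⟩ := by
    intro hρ hρ1 k hk
    subst hp
    exact AL2SGD.expect_lyapunovAt_le hS hn hm hμ hL hlam rfl
      (AL2SGD.admissible_params hn hμ hL hlam hρ hρ1) hs hc hmin x0 hε
      ((Nat.le_ceil _).trans (Nat.cast_le.2 hk))
  refine ⟨fun hμlam hρ => ?_, fun hρ => ?_⟩
  · have hp1 : 1 - p = L / (lam + L) := by
      rw [hp]
      field_simp
      ring
    have hρ0 : 0 < ρ := by
      rw [hρ, hp1, hp]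
      positivity
    have hρ1 : ρ ≤ 1 := by
      rw [hρ]
      nlinarith [sq_nonneg (p - 1 / 2)]
    rw [← hp, ← hρ]
    obtain ⟨hint, he⟩ := AL2SGD.integral_commRounds hS (AL2SGD.iterCount n μ L lam ρ ε)
    exact ⟨hconv hρ0 hρ1, hint,
      he.trans_le (AL2SGD.comm_cost_le hn hμ hL hlam hμL hμlam hp hρ hε hε2)⟩
  · have hm1 : (1 : ℝ) ≤ m := Nat.one_le_cast.2 hm
    have hρ0 : 0 < ρ := by
      rw [hρ]
      positivity
    have hρ1 : ρ ≤ 1 := by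
      rw [hρ]
      exact (div_le_one (by positivity)).2 hm1
    rw [← hρ]
    obtain ⟨hint, he⟩ := AL2SGD.integral_summandGrads hS (AL2SGD.iterCount n μ L lam ρ ε)
    exact ⟨hconv hρ0 hρ1, hint,
      he.trans_le (AL2SGD.grad_cost_le hn hm hμ hL hlam hp hρ hε hε2)⟩
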